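/- A \emph{polyhedron} is a connected surface in $\mathbb{R}^3$ formed of finitely many planar faces, each a simple polygon, such that any two faces are disjoint, or share exactly one vertex, or share exactly one edge; each edge is shared by exactly two faces; and the link of each vertex is a cycle. (Faces meeting at an edge may be coplanar.) Its \emph{genus} is the number $g$ with $V-E+F=2-2g$, where $V,E,F$ are the numbers of vertices, edges and faces. A face is a rectangle if its polygon has exactly four vertices and right angles at all of them. A polyhedron is \emph{orthogonal} if at every edge the dihedral angle between the two faces meeting there is an integer multiple of $\pi/2$. \textbf{Theorem.} Every polyhedron of genus zero or one, all of whose faces are rectangles, is an orthogonal polyhedron: all of its dihedral angles are integer multiples of $\pi/2$. -/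

import Mathlib

/-- Euclidean three-space. -/
abbrev E3 : Type := EuclideanSpace ℝ (Fin 3)

/-- A nondegenerate rectangle in three-space, given by its four corners in cyclic order. -/
structure Rectangle where
  corner : Fin 4 → E3
  parallelogram : corner 1 - corner 0 = corner 2 - corner 3
  right_angle : inner ℝ (corner 1 - corner 0) (corner 3 - corner 0) = 0
  ne_01 : corner 0 ≠ corner 1
  ne_03 : corner 0 ≠ corner 3

namespace Rectangle

/-- The four corners, as a set of points. -/
def corners (R : Rectangle) : Set E3 := Set.range R.corner

/-- The `k`-th side, recorded as the unordered pair of its endpoints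
(indices are taken modulo 4). -/
def side (R : Rectangle) (k : Fin 4) : Sym2 E3 := s(R.corner k, R.corner (k + 1))

/-- The set of the four sides. -/
def sides (R : Rectangle) : Set (Sym2 E3) := Set.range R.side

/-- The closed two-dimensional rectangle. -/
def region (R : Rectangle) : Set E3 := convexHull ℝ R.corners

/-- The vector in the plane of the rectangle, perpendicular to the `k`-th side, pointing from
that side into the rectangle. -/
def inward (R : Rectangle) (k : Fin 4) : E3 := R.corner (k + 2) - R.corner (k + 1)

end Rectangle

/-- The combinatorial link of the point `v` in a family of rectangles: its nodes are the edges
at `v` (recorded by their other endpoint `w`), and two edges at `v` are joined when they are two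
sides of one rectangle of the family. -/
def rectangleLink {ι : Type*} (face : ι → Rectangle) (v : E3) :
    SimpleGraph {w : E3 // ∃ i, s(v, w) ∈ (face i).sides} where
  Adj w w' := w ≠ w' ∧ ∃ i, s(v, w.1) ∈ (face i).sides ∧ s(v, w'.1) ∈ (face i).sides
  symm := ⟨fun _ _ h => ⟨h.1.symm, h.2.imp fun _ hi => ⟨hi.2, hi.1⟩⟩⟩
  loopless := ⟨fun _ h => h.1 rfl⟩

/-- A polyhedron all of whose faces are rectangles, with faces indexed by the (finite) type `ι`:
a connected surface formed of rectangles such that any two faces are disjoint, or share exactly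
one vertex, or share exactly one common edge; every edge lies on exactly two faces; and the
link of every vertex is a cycle. Adjacent faces are allowed to be coplanar. -/
structure RectangularPolyhedron (ι : Type*) where
  face : ι → Rectangle
  face_inter : ∀ i j, i ≠ j →
    (face i).region ∩ (face j).region = ∅ ∨
    (∃ v, v ∈ (face i).corners ∧ v ∈ (face j).corners ∧
      (face i).region ∩ (face j).region = {v}) ∨
    (∃ a b, s(a, b) ∈ (face i).sides ∧ s(a, b) ∈ (face j).sides ∧
      (face i).region ∩ (face j).region = segment ℝ a b)
  edge_two_faces : ∀ i, ∀ e ∈ (face i).sides, {j | e ∈ (face j).sides}.ncard = 2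
  link_cycle : ∀ i, ∀ v ∈ (face i).corners,
    ∃ n, 3 ≤ n ∧ Nonempty (rectangleLink face v ≃g SimpleGraph.cycleGraph n)
  connected : IsConnected (⋃ i, (face i).region)

namespace RectangularPolyhedron

/-- The vertices of the polyhedron. -/
def vertices {ι : Type*} (P : RectangularPolyhedron ι) : Set E3 := ⋃ i, (P.face i).corners

/-- The edges of the polyhedron, as unordered pairs of endpoints. -/
def edges {ι : Type*} (P : RectangularPolyhedron ι) : Set (Sym2 E3) := ⋃ i, (P.face i).sides

/-- The Euler characteristic `V - E + F`. -/
noncomputable def eulerChar {ι : Type*} (P : RectangularPolyhedron ι) : ℤ :=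
  (P.vertices.ncard : ℤ) - (P.edges.ncard : ℤ) + (Nat.card ι : ℤ)

/-- The surface (closed, connected, embedded in three-space, hence orientable) has genus `g`,
i.e. its Euler characteristic is `2 - 2 g`. -/
def HasGenus {ι : Type*} (P : RectangularPolyhedron ι) (g : ℕ) : Prop :=
  P.eulerChar = 2 - 2 * (g : ℤ)

/-- The angle in `[0, π]` between face `i` at its side `k` and face `j` at its side `l`, where
these two sides are the same edge: the angle between the directions that are perpendicular to
the edge and point into the two faces. (On one side of the surface the dihedral angle is this
angle `θ`, on the other side it is `2π - θ`; one is a multiple of `π / 2` exactly when the other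
one is.) -/
noncomputable def dihedralAngle {ι : Type*} (P : RectangularPolyhedron ι)
    (i : ι) (k : Fin 4) (j : ι) (l : Fin 4) : ℝ :=
  InnerProductGeometry.angle ((P.face i).inward k) ((P.face j).inward l)

/-- All dihedral angles are integer multiples of `π / 2`. -/
def IsOrthogonal {ι : Type*} (P : RectangularPolyhedron ι) : Prop :=
  ∀ (i j : ι) (k l : Fin 4), i ≠ j → (P.face i).side k = (P.face j).side l →
    ∃ m : ℤ, P.dihedralAngle i k j l = (m : ℝ) * (Real.pi / 2)

end RectangularPolyhedron

/-!
Each rectangle has a frame, the set of the six unit vectors along its sides and normals. Two faces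
at an edge with the same frame have a dihedral angle that is a multiple of `π / 2`; call the edge
*bent* if the frames differ, and *flat* otherwise. The claim is that a surface with a bent edge
has negative Euler characteristic.

Cut the surface along the bent edges into regions; all faces of a region have the same frame. Let
`V'` and `E'` be the numbers of bent vertices (those on bent edges) and of bent edges, and `r` the
number of regions. Then `χ ≤ V' - E' + r` (`eulerChar_le`). Indeed, modulo 2 the incidence matrix
of faces and flat edges has rank at least `F - r`, the incidence matrix of flat edges and vertices
that are not bent has rank `V - V'`, where `V` and `F` count all vertices and faces, and the
product of these matrices is zero, so the two ranks add up to at most the number of flat edges.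

The sides of bent edges (flags) are paired off by an involution `c` that preserves the vertex and
the region. A flag and its partner have distinct directions in a common frame, so these directions
are either opposite or perpendicular; in the second case the flag is a turn. Let `N = 4 E'` be the
number of flags of bent edges, and `A` the number of turns.

* Every region has at least eight turns (`eight_le_card_turns`). The pairing joins the edges on
  its boundary into closed walks along the axes of its frame. Such a walk never turns back, and
  its displacements sum to zero, so it has at least four turns; each of these is counted at both
  flags of the pair.
* At a vertex with `n` flags of bent edges and `a` turns, `8 + a ≤ 2 n`, with strict inequality if
  `a > 0` (`card_turns_lt`). The reason is that two frames with two perpendicular vectors in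
  common are equal, so frames that differ across every bent edge force a vertex with a turn to
  have at least four bent edges, and exactly four cannot all be separated by turns.

Adding up, `8 χ ≤ 8 V' - 8 E' + 8 r ≤ 8 V' - 2 N + A < 0`. For genus at most one, `χ ≥ 0`, so
there is no bent edge.
-/

open scoped RealInnerProductSpace

/-! ### Involutions on finite sets -/

theorem even_card_of_involution {α : Type*} (S : Finset α) (t : α → α)
    (hmem : ∀ a ∈ S, t a ∈ S) (hinv : ∀ a ∈ S, t (t a) = a) (hne : ∀ a ∈ S, t a ≠ a) :
    Even S.card := by
  have h : ∑ _a ∈ S, (1 : ZMod 2) = 0 :=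
    Finset.sum_involution (fun a _ => t a) (fun _ _ => by decide) (fun a ha _ => hne a ha)
      hmem hinv
  rw [Finset.sum_const, nsmul_eq_mul, mul_one] at h
  exact (ZMod.natCast_eq_zero_iff_even).1 h

theorem exists_involutive_of_even_card {α : Type*} [Finite α] (h : Even (Nat.card α)) :
    ∃ c : α → α, Function.Involutive c ∧ ∀ a, c a ≠ a := by
  obtain ⟨m, hm⟩ := h
  let e : α ≃ Fin m × Bool := (Finite.card_eq.1 (by simp [hm, mul_two])).some
  refine ⟨fun a => e.symm ((e a).1, !(e a).2), fun a => by simp, fun a ha => ?_⟩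
  have h1 := congrArg (fun x => (e x).2) ha
  simp at h1

/-- If a function has finite fibers of even size, the points of each fiber can be paired off. -/
theorem exists_involutive_of_even_fibers {α β : Type*} [Finite α] (κ : α → β)
    (h : ∀ b, Even (Nat.card {a // κ a = b})) :
    ∃ c : α → α, Function.Involutive c ∧ (∀ a, c a ≠ a) ∧ ∀ a, κ (c a) = κ a := by
  choose c hc hne using fun b => exists_involutive_of_even_card (h b)
  have key : ∀ a b (hb : κ a = b), (c (κ a) ⟨a, rfl⟩).1 = (c b ⟨a, hb⟩).1 := by
    rintro a _ rfl
    rfl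
  refine ⟨fun a => (c (κ a) ⟨a, rfl⟩).1, fun a => ?_, fun a ha => ?_, fun a => ?_⟩
  · have h1 := key (c (κ a) ⟨a, rfl⟩).1 (κ a) (c (κ a) ⟨a, rfl⟩).2
    refine h1.trans ?_
    exact congrArg Subtype.val (hc (κ a) ⟨a, rfl⟩)
  · exact hne (κ a) ⟨a, rfl⟩ (Subtype.ext ha)
  · exact (c (κ a) ⟨a, rfl⟩).2

/-- For two fixed-point-free involutions `s` and `c`, the group generated by them is dihedral and
acts freely, so a cycle of the rotation `c * s` contains no point together with its mirror image
under the reflection `s`. -/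
theorem not_sameCycle_of_involutive {α : Type*} (s c : Equiv.Perm α)
    (hs : ∀ a, s (s a) = a) (hc : ∀ a, c (c a) = a) (hs' : ∀ a, s a ≠ a) (hc' : ∀ a, c a ≠ a)
    (a : α) : ¬ (c * s).SameCycle a (s a) := by
  have hss : s * s = 1 := Equiv.ext hs
  have hcc : c * c = 1 := Equiv.ext hc
  have hsi : s⁻¹ = s := inv_eq_of_mul_eq_one_left hss
  have hci : c⁻¹ = c := inv_eq_of_mul_eq_one_left hcc
  have hconj : s * (c * s) * s⁻¹ = (c * s)⁻¹ := by
    rw [mul_inv_rev, hsi, hci, mul_assoc, mul_assoc, hss, mul_one]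
  have hpow : ∀ (m : ℤ) x, s (((c * s) ^ m) x) = ((c * s) ^ (-m)) (s x) := by
    intro m x
    have : s * (c * s) ^ m = (c * s) ^ (-m) * s := by
      rw [zpow_neg, ← inv_zpow, ← hconj, conj_zpow, mul_assoc, mul_assoc, hsi, hss, mul_one]
    exact congrArg (fun g : Equiv.Perm α => g x) this
  rintro ⟨k, hk⟩
  obtain ⟨m, rfl | rfl⟩ := k.even_or_odd'
  · refine hs' (((c * s) ^ m) a) ?_
    rw [hpow, ← hk, two_mul, ← Equiv.Perm.mul_apply, ← zpow_add]
    simp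
  · refine hc' (s (((c * s) ^ m) a)) ?_
    have h1 : c (s (((c * s) ^ m) a)) = ((c * s) ^ (m + 1)) a := by
      rw [add_comm, zpow_add, zpow_one]; rfl
    rw [h1, hpow, ← hk, ← Equiv.Perm.mul_apply, ← zpow_add]
    congr 2
    ring

/-! ### Orthonormal frames -/

/-- The set of the six vectors `±b k` of some orthonormal basis `b` of space. -/
def IsFrame (S : Set E3) : Prop :=
  ∃ b : OrthonormalBasis (Fin 3) ℝ E3, S = {u | ∃ k, u = b k ∨ u = -b k}

namespace IsFrame

variable {S T : Set E3}

theorem norm_eq_one (h : IsFrame S) {u : E3} (hu : u ∈ S) : ‖u‖ = 1 := by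
  obtain ⟨b, rfl⟩ := h
  obtain ⟨k, rfl | rfl⟩ := hu <;> simp

theorem neg_mem (h : IsFrame S) {u : E3} (hu : u ∈ S) : -u ∈ S := by
  obtain ⟨b, rfl⟩ := h
  obtain ⟨k, rfl | rfl⟩ := hu
  · exact ⟨k, Or.inr rfl⟩
  · exact ⟨k, Or.inl (neg_neg _)⟩

theorem eq_or_eq_neg_or_inner (h : IsFrame S) {u w : E3} (hu : u ∈ S) (hw : w ∈ S) :
    u = w ∨ u = -w ∨ ⟪u, w⟫ = 0 := by
  obtain ⟨b, rfl⟩ := h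
  obtain ⟨k, hk⟩ := hu
  obtain ⟨l, hl⟩ := hw
  by_cases hkl : k = l
  · subst hkl
    rcases hk with rfl | rfl <;> rcases hl with rfl | rfl <;> simp
  · have := b.inner_eq_zero hkl
    rcases hk with rfl | rfl <;> rcases hl with rfl | rfl <;> simp [this]

theorem _root_.OrthonormalBasis.eq_or_eq_neg_of_inner_eq_zero
    (b : OrthonormalBasis (Fin 3) ℝ E3) (m : Fin 3) {z : E3} (hz : ‖z‖ = 1)
    (h : ∀ n, n ≠ m → ⟪b n, z⟫ = 0) : z = b m ∨ z = -b m := by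
  have hsum : z = ⟪b m, z⟫ • b m := by
    conv_lhs => rw [← b.sum_repr' z]
    exact Finset.sum_eq_single m (fun n _ hn => by simp [h n hn]) (by simp)
  have habs : |⟪b m, z⟫| = 1 := by
    rw [hsum, norm_smul, b.norm_eq_one, mul_one, Real.norm_eq_abs] at hz
    exact hz
  rcases eq_or_eq_neg_of_abs_eq habs with h1 | h1 <;> rw [h1] at hsum
  · left; simpa using hsum
  · right; simpa using hsum

theorem mem_of_orthogonal (h : IsFrame S) {u w z : E3} (hu : u ∈ S) (hw : w ∈ S)
    (huw : ⟪u, w⟫ = 0) (hz : ‖z‖ = 1) (hzu : ⟪u, z⟫ = 0) (hzw : ⟪w, z⟫ = 0) : z ∈ S := by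
  obtain ⟨b, rfl⟩ := h
  obtain ⟨k, hk⟩ := hu
  obtain ⟨l, hl⟩ := hw
  have hkl : k ≠ l := by
    rintro rfl
    rcases hk with rfl | rfl <;> rcases hl with rfl | rfl <;> simp at huw
  have hk0 : ⟪b k, z⟫ = 0 := by rcases hk with rfl | rfl <;> simpa using hzu
  have hl0 : ⟪b l, z⟫ = 0 := by rcases hl with rfl | rfl <;> simpa using hzw
  obtain ⟨m, hm⟩ : ∃ m : Fin 3, ∀ n, n ≠ m → n = k ∨ n = l := by
    revert hkl; clear * -; revert k l; decide
  refine ⟨m, b.eq_or_eq_neg_of_inner_eq_zero m hz fun n hn => ?_⟩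
  rcases hm n hn with rfl | rfl
  · exact hk0
  · exact hl0

theorem subset_of_two_mem (hS : IsFrame S) (hT : IsFrame T) {u w : E3} (huS : u ∈ S)
    (hwS : w ∈ S) (huT : u ∈ T) (hwT : w ∈ T) (huw : ⟪u, w⟫ = 0) : S ⊆ T := by
  intro z hz
  rcases hS.eq_or_eq_neg_or_inner hz huS with rfl | rfl | h1
  · exact huT
  · exact hT.neg_mem huT
  rcases hS.eq_or_eq_neg_or_inner hz hwS with rfl | rfl | h2
  · exact hwT
  · exact hT.neg_mem hwT
  exact hT.mem_of_orthogonal huT hwT huw (hS.norm_eq_one hz) (by rwa [real_inner_comm])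
    (by rwa [real_inner_comm])

/-- A frame is determined by two of its vectors that are perpendicular. -/
theorem eq_of_two_mem (hS : IsFrame S) (hT : IsFrame T) {u w : E3} (huS : u ∈ S)
    (hwS : w ∈ S) (huT : u ∈ T) (hwT : w ∈ T) (huw : ⟪u, w⟫ = 0) : S = T :=
  (hS.subset_of_two_mem hT huS hwS huT hwT huw).antisymm
    (hT.subset_of_two_mem hS huT hwT huS hwS huw)

theorem neg_ne (h : IsFrame S) {u : E3} (hu : u ∈ S) : -u ≠ u := by
  intro h0
  have h1 : u = 0 := by
    have : (2 : ℝ) • u = 0 := by rw [two_smul]; nth_rewrite 1 [← h0]; simp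
    simpa using this
  have := h.norm_eq_one hu
  simp [h1] at this

/-- A closed chain of four unit vectors, each perpendicular to the next, has a pair of opposite
members on a common line. -/
theorem parallel_of_four_cycle (h : IsFrame S) {u w y q : E3} (hu : u ∈ S) (hw : w ∈ S)
    (hy : ‖y‖ = 1) (hq : ‖q‖ = 1) (huw : ⟪u, w⟫ = 0) (hwy : ⟪w, y⟫ = 0) (hyq : ⟪y, q⟫ = 0)
    (hqu : ⟪q, u⟫ = 0) : (y = u ∨ y = -u) ∨ (q = w ∨ q = -w) := by
  obtain ⟨b, rfl⟩ := h
  obtain ⟨k, hk⟩ := hu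
  obtain ⟨l, hl⟩ := hw
  have hkl : k ≠ l := by
    rintro rfl
    rcases hk with rfl | rfl <;> rcases hl with rfl | rfl <;> simp at huw
  rw [real_inner_comm] at hqu
  have hk0 : ⟪b k, q⟫ = 0 := by rcases hk with rfl | rfl <;> simpa using hqu
  have hl0 : ⟪b l, y⟫ = 0 := by rcases hl with rfl | rfl <;> simpa using hwy
  obtain ⟨m, hm⟩ : ∃ m : Fin 3, ∀ n, n ≠ m → n = k ∨ n = l := by
    revert hkl; clear * -; revert k l; decide
  -- Only the coordinate along the third axis contributes to the inner product of `y` and `q`.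
  have hprod : ⟪y, b m⟫ * ⟪b m, q⟫ = 0 := by
    rw [← hyq, ← b.sum_inner_mul_inner y q]
    symm
    refine Finset.sum_eq_single_of_mem m (Finset.mem_univ m) fun n _ hn => ?_
    rcases hm n hn with rfl | rfl
    · simp [hk0]
    · rw [real_inner_comm, hl0, zero_mul]
  have pm : ∀ {z v e : E3}, v = e ∨ v = -e → z = e ∨ z = -e → z = v ∨ z = -v := by
    rintro z v e (rfl | rfl) (rfl | rfl) <;> simp
  rcases mul_eq_zero.1 hprod with h0 | h0
  · left
    rw [real_inner_comm] at h0
    refine pm hk (b.eq_or_eq_neg_of_inner_eq_zero k hy fun n hn => ?_)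
    by_cases hnm : n = m
    · rw [hnm, h0]
    · rw [(hm n hnm).resolve_left hn, hl0]
  · right
    refine pm hl (b.eq_or_eq_neg_of_inner_eq_zero l hq fun n hn => ?_)
    by_cases hnm : n = m
    · rw [hnm, h0]
    · rw [(hm n hnm).resolve_right hn, hk0]

end IsFrame

/-! ### Bent edges at one vertex -/

/-- If `t` is fixed-point free and preserves `p`, then `n` distinct values of `p` are taken at
`2 * n` points at least, and if there are no further points, there are no further values. -/
theorem card_of_injective_comp {α β : Type*} [Fintype α] {t : α → α} {p : α → β}
    (hpt : ∀ a, p (t a) = p a) (ht : ∀ a, t a ≠ a) {n : ℕ} (y : Fin n → α)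
    (hy : Function.Injective (p ∘ y)) :
    2 * n ≤ Fintype.card α ∧ (Fintype.card α = 2 * n → ∀ a, ∃ i, p a = p (y i)) := by
  let f : Fin n × Bool → α := fun x => if x.2 then t (y x.1) else y x.1
  have hpf : ∀ x, p (f x) = p (y x.1) := by
    rintro ⟨i, _ | _⟩ <;> simp [f, hpt]
  have hf : Function.Injective f := by
    rintro ⟨i, b⟩ ⟨j, b'⟩ h
    obtain rfl : i = j := hy (((hpf _).symm.trans (congrArg p h)).trans (hpf _))
    have h' : (if b then t (y i) else y i) = if b' then t (y i) else y i := h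
    cases b <;> cases b' <;> simp [ht, (ht _).symm] at h' ⊢
  have hcard : Fintype.card (Fin n × Bool) = 2 * n := by simp [mul_comm]
  refine ⟨hcard ▸ Fintype.card_le_of_injective f hf, fun h a => ?_⟩
  have hbij := (Fintype.bijective_iff_injective_and_card f).2 ⟨hf, hcard.trans h.symm⟩
  obtain ⟨x, rfl⟩ := hbij.2 a
  exact ⟨x.1, hpf x⟩

/-- The vertex inequality. The points of `α` stand for the sides `a` of bent edges at a vertex, `p`
for their directions, `Fr` for the frames of the incident faces; `t` goes to the other side of the
same edge and `c` to another side in the same frame. If the vertex has a turn, meaning that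
`p a` and `p (c a)` are perpendicular, then it has at least four bent edges, and if there are
exactly four, not all of the passages are turns. -/
theorem card_turns_lt {α : Type*} [Fintype α] (t c : α → α) (p : α → E3) (Fr : α → Set E3)
    (hc : ∀ a, c (c a) = a) (ht : ∀ a, t (t a) = a)
    (hF : ∀ a, IsFrame (Fr a)) (hp : ∀ a, p a ∈ Fr a) (hFc : ∀ a, Fr (c a) = Fr a)
    (hFt : ∀ a, Fr (t a) ≠ Fr a) (hpt : ∀ a, p (t a) = p a) (hpc : ∀ a, p (c a) ≠ p a)
    (hinj : ∀ a b, p a = p b → b = a ∨ b = t a)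
    (a : α) (ha : ⟪p a, p (c a)⟫ = 0) :
    8 + Nat.card {a // ⟪p a, p (c a)⟫ = 0} < 2 * Nat.card α := by
  have hta : ∀ a, t a ≠ a := fun a h => hFt a (congrArg Fr h)
  have hd : ∀ a, p (c a) = -p a ∨ ⟪p a, p (c a)⟫ = 0 := by
    intro a
    have h1 : p (c a) ∈ Fr a := hFc a ▸ hp (c a)
    rcases (hF a).eq_or_eq_neg_or_inner h1 (hp a) with h | h | h
    · exact absurd h (hpc a)
    · exact Or.inl h
    · right; rwa [real_inner_comm]
  -- After a turn, the next direction is not on the line of the first one.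
  have step : ∀ a, ⟪p a, p (c a)⟫ = 0 →
      p (c (t (c a))) ≠ p a ∧ p (c (t (c a))) ≠ -p a := by
    intro a ha
    have key : p a ∉ Fr (t (c a)) := by
      intro hmem
      refine hFt (c a) ?_
      rw [hFc]
      exact (hF _).eq_of_two_mem (hF _) hmem (hpt (c a) ▸ hp (t (c a))) (hp a)
        (hFc a ▸ hp (c a)) ha
    have h2 : p (c (t (c a))) ∈ Fr (t (c a)) := hFc (t (c a)) ▸ hp (c (t (c a)))
    refine ⟨fun h => key (h ▸ h2), fun h => key ?_⟩
    have := (hF _).neg_mem h2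
    rwa [h, neg_neg] at this
  obtain ⟨h20, h20'⟩ := step a ha
  -- The points `a`, `x1`, `x3`, `x5` lie on consecutive bent edges around the vertex; the
  -- directions of these four edges are shown to be distinct.
  set x1 := c a with hx1
  set x3 := c (t x1) with hx3
  set x5 := c (t x3) with hx5
  have hc1 : c x1 = a := hc a
  have hc3 : c x3 = t x1 := hc _
  have hc5 : c x5 = t x3 := hc _
  have h10 : p x1 ≠ p a := hpc a
  have h21 : p x3 ≠ p x1 := fun h => hpc (t x1) (by rw [hpt]; exact h)
  have h32 : p x5 ≠ p x3 := fun h => hpc (t x3) (by rw [hpt]; exact h)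
  have h31 : p x5 ≠ p x1 := by
    intro h
    rcases hinj _ _ h with h | h
    · refine h20 ?_
      have : a = t x3 := by rw [← hc1, h, hc5]
      rw [this, hpt]
    · refine h21 ?_
      have h' : x5 = t x1 := by rw [h, ht]
      have : t x3 = x3 := by rw [← hc5, h']
      exact absurd this (hta _)
  have h30 : p x5 ≠ p a := by
    intro h
    have hF5 : Fr x5 = Fr x3 → False := by
      intro h'
      refine hFt x3 ?_
      rw [← h', hx5, hFc]
    have m3 : p x3 ∈ Fr x5 := by rw [hx5, hFc, ← hpt]; exact hp _
    have m0 : p a ∈ Fr x5 := h ▸ hp x5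
    have m1 : p x1 ∈ Fr x3 := by rw [hx3, hFc, ← hpt]; exact hp _
    have m1' : p x1 ∈ Fr a := hFc a ▸ hp x1
    have h02 : ⟪p a, p x3⟫ = 0 := by
      rcases (hF x5).eq_or_eq_neg_or_inner m0 m3 with h' | h' | h'
      · exact absurd h'.symm h20
      · exact absurd (by rw [h', neg_neg]) h20'
      · exact h'
    rcases hd (t x1) with h' | h'
    · -- A straight passage after a turn: the first and the third frame coincide.
      rw [hpt] at h'
      have hmem : p x3 ∈ Fr a := by rw [hx3, h']; exact (hF a).neg_mem m1'
      have hEq : Fr x5 = Fr a := (hF _).eq_of_two_mem (hF _) m0 m3 (hp a) hmem h02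
      rcases hinj _ _ h with h'' | h''
      · refine h21 ?_
        rw [hx1, h'', hc5, hpt]
      · exact hFt x5 (by rw [← h'', hEq])
    · -- Two turns in a row close up to an orthonormal triple, and the first two frames coincide.
      rw [hpt] at h'
      have hmem : p x3 ∈ Fr a := (hF a).mem_of_orthogonal (hp a) m1' ha
        ((hF _).norm_eq_one (hp x3)) h02 h'
      have hEq : Fr x3 = Fr a := (hF _).eq_of_two_mem (hF _) m1 (hp x3) m1' hmem h'
      refine hFt x1 ?_
      rw [← hFc (t x1), ← hx3, hEq, hx1, hFc]
  obtain ⟨hcard, hall⟩ := card_of_injective_comp hpt hta ![a, x1, x3, x5] (by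
    intro i j
    fin_cases i <;> fin_cases j <;>
      simp [h10, h10.symm, h20, h20.symm, h21, h21.symm, h30, h30.symm, h31, h31.symm, h32,
        h32.symm])
  have hle := Nat.card_eq_fintype_card (α := α) ▸
    Finite.card_subtype_le (fun a => ⟪p a, p (c a)⟫ = 0)
  rw [Nat.card_eq_fintype_card (α := α)]
  by_contra hlt
  have h8 : Fintype.card α = 2 * 4 := by omega
  have hturn : ∀ b, ⟪p b, p (c b)⟫ = 0 := by
    by_contra! hb
    obtain ⟨b, hb⟩ := hb
    have := Finite.card_subtype_lt (p := fun a => ⟪p a, p (c a)⟫ = 0) hb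
    rw [Nat.card_eq_fintype_card (α := α)] at this
    omega
  -- With four edges and only turns, the directions would form a closed chain of four.
  obtain ⟨i, hi⟩ := hall h8 (c (t x5))
  have hclose : p (c (t x5)) = p a := by
    fin_cases i
    · exact hi
    · exfalso
      have hi' : p x1 = p (c (t x5)) := hi.symm
      rcases hinj _ _ hi' with h | h
      · refine h30 ?_
        rw [← hc1, ← h, hc, hpt]
      · refine h32 ?_
        rw [hx3, ← h, hc, hpt]
    · exfalso
      have := (step (t x3) (hturn _)).1
      rw [hpt] at this
      exact this hi
    · exact absurd (hi.trans (hpt x5).symm) (hpc (t x5))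
  have h12 := hturn (t x1)
  have h23 := hturn (t x3)
  have h34 := hturn (t x5)
  rw [hpt] at h12 h23 h34
  rw [hclose] at h34
  have h13 := step (t x1) (hturn _)
  rw [hpt] at h13
  rcases (hF a).parallel_of_four_cycle (hp a) (hFc a ▸ hp x1) ((hF _).norm_eq_one (hp x3))
    ((hF _).norm_eq_one (hp x5)) ha h12 h23 h34 with (h | h) | (h | h)
  · exact h20 h
  · exact h20' h
  · exact h13.1 h
  · exact h13.2 h

theorem four_le_card_of_dir_ne {α : Type*} [Fintype α] [Nonempty α] (t c : α → α) (p : α → E3)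
    (hta : ∀ a, t a ≠ a) (hpt : ∀ a, p (t a) = p a) (hpc : ∀ a, p (c a) ≠ p a) :
    4 ≤ Nat.card α := by
  obtain ⟨a⟩ := ‹Nonempty α›
  have h := (card_of_injective_comp hpt hta ![a, c a] (by
    intro i j
    fin_cases i <;> fin_cases j <;> simp [hpc a, (hpc a).symm])).1
  rw [Nat.card_eq_fintype_card]
  omega

/-! ### Turns on the boundary of a region -/

section Turns

/- A finite set `T` of steps that is invariant under the successor permutation `n`: the step `a`
starts at `x a` and goes the distance `len a` in the direction `p a`. -/

variable {α : Type*} {n : Equiv.Perm α} {T : Finset α}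

theorem map_perm_eq (hT : ∀ a ∈ T, n a ∈ T) : T.map n.toEmbedding = T :=
  Finset.eq_of_subset_of_card_le
    (fun _ h => by
      obtain ⟨a, ha, rfl⟩ := Finset.mem_map.1 h
      exact hT a ha)
    (by simp)

theorem sum_perm_sub_eq_zero {M : Type*} [AddCommGroup M] (x : α → M) (hT : ∀ a ∈ T, n a ∈ T) :
    ∑ a ∈ T, (x (n a) - x a) = 0 := by
  rw [Finset.sum_sub_distrib, sub_eq_zero]
  conv_rhs => rw [← map_perm_eq hT]
  simp

variable {x p : α → E3} {len : α → ℝ}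

theorem sum_len_mul_inner (hx : ∀ a, x (n a) - x a = len a • p a) (hT : ∀ a ∈ T, n a ∈ T)
    (e : E3) : ∑ a ∈ T, len a * ⟪e, p a⟫ = 0 := by
  have h := congrArg (fun v => ⟪e, v⟫) (sum_perm_sub_eq_zero x hT)
  simpa [inner_sum, hx, inner_smul_right] using h

/-- A walk cannot go on in one direction for ever, as it comes back to where it started. -/
theorem exists_exit (hx : ∀ a, x (n a) - x a = len a • p a) (hlen : ∀ a, 0 < len a)
    (hT : ∀ a ∈ T, n a ∈ T) {e : E3} (he : ‖e‖ = 1) (h : ∃ a ∈ T, p a = e) :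
    ∃ a ∈ T, p a = e ∧ p (n a) ≠ e := by
  classical
  by_contra! hcon
  have h0 := sum_len_mul_inner (T := T.filter fun a => p a = e) hx (fun a ha => by
    rw [Finset.mem_filter] at ha ⊢
    exact ⟨hT a ha.1, hcon a ha.1 ha.2⟩) e
  refine h0.not_gt (Finset.sum_pos (fun a ha => ?_) ?_)
  · rw [(Finset.mem_filter.1 ha).2, real_inner_self_eq_norm_sq, he]
    simpa using hlen a
  · obtain ⟨a, ha⟩ := h
    exact ⟨a, Finset.mem_filter.2 ha⟩

/-- The steps in direction `e` and the steps followed by one in direction `e` are equally many, so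
an exit from the direction `e` is balanced by an entry. -/
theorem exists_enter (hx : ∀ a, x (n a) - x a = len a • p a) (hlen : ∀ a, 0 < len a)
    (hT : ∀ a ∈ T, n a ∈ T) {e : E3} (he : ‖e‖ = 1) (h : ∃ a ∈ T, p a = e) :
    ∃ a ∈ T, p a ≠ e ∧ p (n a) = e := by
  classical
  by_contra! hcon
  obtain ⟨a, ha, hae, hna⟩ := exists_exit hx hlen hT he h
  have hsub : (T.filter fun a => p (n a) = e) ⊆ T.filter fun a => p a = e := by
    intro b hb
    rw [Finset.mem_filter] at hb ⊢
    exact ⟨hb.1, by_contra fun hne => hcon b hb.1 hne hb.2⟩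
  have hcard : (T.filter fun a => p a = e).card = (T.filter fun a => p (n a) = e).card := by
    conv_lhs => rw [← map_perm_eq hT, Finset.filter_map, Finset.card_map]
    rfl
  have := Finset.eq_of_subset_of_card_le hsub hcard.le
  have hmem : a ∈ T.filter fun a => p (n a) = e := this ▸ Finset.mem_filter.2 ⟨ha, hae⟩
  exact hna (Finset.mem_filter.1 hmem).2

variable {S : Set E3}

/-- The displacements along the axis of `p a` cancel, so some step goes the opposite way. -/
theorem exists_opposite (hS : IsFrame S) (hp : ∀ a, p a ∈ S)
    (hx : ∀ a, x (n a) - x a = len a • p a) (hlen : ∀ a, 0 < len a)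
    (hT : ∀ a ∈ T, n a ∈ T) {a : α} (ha : a ∈ T) : ∃ b ∈ T, p b = -p a := by
  by_contra! hcon
  refine (sum_len_mul_inner hx hT (p a)).not_gt (Finset.sum_pos' (fun b hb => ?_) ⟨a, ha, ?_⟩)
  · rcases hS.eq_or_eq_neg_or_inner (hp b) (hp a) with h | h | h
    · rw [h, real_inner_self_eq_norm_sq]
      exact mul_nonneg (hlen b).le (sq_nonneg _)
    · exact absurd h (hcon b hb)
    · rw [real_inner_comm, h, mul_zero]
  · rw [real_inner_self_eq_norm_sq, hS.norm_eq_one (hp a)]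
    simpa using hlen a

/-- A closed walk along the axes of a frame that never turns back has at least four turns. -/
theorem four_le_card_turns [Finite α] (hS : IsFrame S) (hp : ∀ a, p a ∈ S)
    (hx : ∀ a, x (n a) - x a = len a • p a) (hlen : ∀ a, 0 < len a)
    (hback : ∀ a, p (n a) ≠ -p a) (hT : ∀ a ∈ T, n a ∈ T) (hne : T.Nonempty) :
    4 ≤ Nat.card {a // a ∈ T ∧ p (n a) ≠ p a} := by
  obtain ⟨a, ha⟩ := hne
  obtain ⟨b, hb, hba⟩ := exists_opposite hS hp hx hlen hT ha
  have h1 := hS.norm_eq_one (hp a)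
  have h1' : ‖-p a‖ = 1 := by rwa [norm_neg]
  have hnn := hS.neg_ne (hp a)
  obtain ⟨f1, m1, l1, r1⟩ := exists_exit hx hlen hT h1 ⟨a, ha, rfl⟩
  obtain ⟨f2, m2, l2, r2⟩ := exists_enter hx hlen hT h1 ⟨a, ha, rfl⟩
  obtain ⟨f3, m3, l3, r3⟩ := exists_exit hx hlen hT h1' ⟨b, hb, hba⟩
  obtain ⟨f4, m4, l4, r4⟩ := exists_enter hx hlen hT h1' ⟨b, hb, hba⟩
  have h12 : f1 ≠ f2 := by rintro rfl; exact l2 l1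
  have h13 : f1 ≠ f3 := by rintro rfl; exact hnn (l3.symm.trans l1)
  have h14 : f1 ≠ f4 := by rintro rfl; exact hback f1 (by rw [r4, l1])
  have h23 : f2 ≠ f3 := by rintro rfl; exact hback f2 (by rw [r2, l3, neg_neg])
  have h24 : f2 ≠ f4 := by rintro rfl; exact hnn (r4.symm.trans r2)
  have h34 : f3 ≠ f4 := by rintro rfl; exact l4 l3
  let g : Fin 4 → {a // a ∈ T ∧ p (n a) ≠ p a} :=
    ![⟨f1, m1, l1 ▸ r1⟩, ⟨f2, m2, fun h => l2 (h ▸ r2)⟩, ⟨f3, m3, l3 ▸ r3⟩,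
      ⟨f4, m4, fun h => l4 (h ▸ r4)⟩]
  have hg : Function.Injective g := by
    intro i j
    fin_cases i <;> fin_cases j <;>
      simp [g, h12, h12.symm, h13, h13.symm, h14, h14.symm, h23, h23.symm, h24, h24.symm, h34,
        h34.symm]
  simpa using Nat.card_le_card_of_injective g hg

end Turns

/-- The region inequality. The points of `α` stand for the darts (directed bent edges) on the
boundary of a region with frame `S`: `x` is the starting point, `p` the direction, `s` reverses a
dart, and `c` passes to a dart with the same start. Following `c ∘ s` and its inverse
traverses the boundary in both ways, and each way makes at least four turns. -/
theorem eight_le_card_turns {α : Type*} [Fintype α] [Nonempty α] {S : Set E3} (hS : IsFrame S)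
    (s c : α → α) (x p : α → E3) (len : α → ℝ)
    (hs : ∀ a, s (s a) = a) (hc : ∀ a, c (c a) = a) (hp : ∀ a, p a ∈ S)
    (hx : ∀ a, x (s a) - x a = len a • p a) (hlen : ∀ a, 0 < len a)
    (hps : ∀ a, p (s a) = -p a) (hxc : ∀ a, x (c a) = x a) (hpc : ∀ a, p (c a) ≠ p a) :
    8 ≤ Nat.card {a // ⟪p a, p (c a)⟫ = 0} := by
  classical
  have hsa : ∀ a, s a ≠ a := fun a h => hS.neg_ne (hp a) (by rw [← hps, h])
  have hca : ∀ a, c a ≠ a := fun a h => hpc a (congrArg p h)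
  let s' : Equiv.Perm α := ⟨s, s, hs, hs⟩
  let c' : Equiv.Perm α := ⟨c, c, hc, hc⟩
  let n : Equiv.Perm α := c' * s'
  have hn : ∀ a, n a = c (s a) := fun _ => rfl
  have hnx : ∀ a, x (n a) - x a = len a • p a := fun a => by rw [hn, hxc, hx]
  have hback : ∀ a, p (n a) ≠ -p a := fun a h => hpc (s a) (by rw [← hn, h, hps])
  obtain ⟨a⟩ := ‹Nonempty α›
  let T : Finset α := Finset.univ.filter fun b => n.SameCycle a b
  have hTm : ∀ b, b ∈ T ↔ n.SameCycle a b := fun b => by simp [T]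
  have hT : ∀ b ∈ T, n b ∈ T := fun b hb => by
    rw [hTm] at hb ⊢
    exact Equiv.Perm.sameCycle_apply_right.2 hb
  have h4 := four_le_card_turns (T := T) hS hp hnx hlen hback hT
    ⟨a, (hTm a).2 (Equiv.Perm.SameCycle.refl n a)⟩
  have hsT : ∀ b ∈ T, s b ∉ T := fun b hb hsb => by
    rw [hTm] at hb hsb
    exact not_sameCycle_of_involutive s' c' hs hc hsa hca b (hb.symm.trans hsb)
  have hturn : ∀ b, p (n b) ≠ p b → ⟪p (s b), p (n b)⟫ = 0 := by
    intro b hb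
    rcases hS.eq_or_eq_neg_or_inner (hp (s b)) (hp (n b)) with h | h | h
    · exact absurd h.symm (hpc (s b))
    · exact absurd (by rw [← neg_neg (p (n b)), ← h, hps, neg_neg]) hb
    · exact h
  let g : {b // b ∈ T ∧ p (n b) ≠ p b} × Bool → {b // ⟪p b, p (c b)⟫ = 0} := fun b =>
    if b.2 then ⟨s b.1, hturn b.1 b.1.2.2⟩
    else ⟨n b.1, by
      rw [hn, hc, real_inner_comm, ← hn]
      exact hturn b.1 b.1.2.2⟩
  have hg : Function.Injective g := by
    rintro ⟨⟨b, hb, hb'⟩, i⟩ ⟨⟨d, hd, hd'⟩, j⟩ h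
    have h1 := congrArg Subtype.val h
    cases i <;> cases j <;> simp only [g] at h1
    · simpa using h1
    · exact absurd (show s d ∈ T from (show n b = s d from h1) ▸ hT b hb) (hsT d hd)
    · exact absurd (show s b ∈ T from (show s b = n d from h1) ▸ hT d hd) (hsT b hb)
    · have : b = d := by rw [← hs b, ← hs d]; exact congrArg s h1
      simp [this]
  have h8 := Nat.card_le_card_of_injective g hg
  rw [Nat.card_prod] at h8
  simp only [Nat.card_eq_fintype_card, Fintype.card_bool] at h8 h4 ⊢
  omega

/-! ### Rectangles -/

theorem inv_norm_smul_pos_smul {u : E3} (hu : ‖u‖ = 1) {r : ℝ} (hr : 0 < r) :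
    ‖r • u‖⁻¹ • (r • u) = u := by
  rw [norm_smul, hu, mul_one, Real.norm_of_nonneg hr.le, smul_smul, inv_mul_cancel₀ hr.ne',
    one_smul]

namespace Rectangle

variable (R : Rectangle)

theorem corner_two : R.corner 2 = R.corner 1 + R.corner 3 - R.corner 0 := by
  have h := R.parallelogram
  rw [sub_eq_sub_iff_add_eq_add] at h
  rw [h]; abel

theorem inward_eq (k : Fin 4) : R.inward k = R.corner (k + 3) - R.corner k := by
  unfold inward
  have h := R.corner_two
  fin_cases k <;> simp <;> rw [h] <;> abel

theorem inner_side_inward (k : Fin 4) :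
    ⟪R.corner (k + 1) - R.corner k, R.corner (k + 3) - R.corner k⟫ = 0 := by
  have h := R.corner_two
  have h0 := R.right_angle
  set a := R.corner 1 - R.corner 0 with ha
  set d := R.corner 3 - R.corner 0 with hd
  have h1 : R.corner 1 = R.corner 0 + a := by rw [ha]; abel
  have h3 : R.corner 3 = R.corner 0 + d := by rw [hd]; abel
  have h2 : R.corner 2 = R.corner 0 + a + d := by rw [h, ha, hd]; abel
  have h0' : ⟪d, a⟫ = 0 := by rwa [real_inner_comm]
  fin_cases k
  · simpa using h0
  · have e1 : R.corner 2 - R.corner 1 = d := by rw [h1, h2]; abel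
    have e2 : R.corner 0 - R.corner 1 = -a := by rw [h1]; abel
    simp [e1, e2, h0']
  · have e1 : R.corner 3 - R.corner 2 = -a := by rw [h3, h2]; abel
    have e2 : R.corner 1 - R.corner 2 = -d := by rw [h1, h2]; abel
    simp [e1, e2, h0]
  · have e1 : R.corner 0 - R.corner 3 = -d := by rw [h3]; abel
    have e2 : R.corner 2 - R.corner 3 = a := by rw [h3, h2]; abel
    simp [e1, e2, h0']

theorem corner_ne_corner_add_one (k : Fin 4) : R.corner k ≠ R.corner (k + 1) := by
  have h := R.corner_two
  have h1 := R.ne_01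
  have h3 := R.ne_03
  fin_cases k
  · exact h1
  · intro e
    have e' : R.corner 1 = R.corner 2 := e
    rw [h, ← sub_eq_zero] at e'
    exact h3 (by rw [← sub_eq_zero, ← e']; abel)
  · intro e
    have e' : R.corner 2 = R.corner 3 := e
    rw [h, ← sub_eq_zero] at e'
    exact h1.symm (by rw [← sub_eq_zero, ← e']; abel)
  · exact fun e => h3.symm e

theorem corner_add_three_ne (k : Fin 4) : R.corner (k + 3) ≠ R.corner k := by
  have h := R.corner_ne_corner_add_one (k + 3)
  rwa [add_assoc, show (3 + 1 : Fin 4) = 0 from rfl, add_zero] at h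

/-- The two corners off a side lie strictly on the inner side of its line. -/
theorem inner_inward_corner (k m : Fin 4) (hm : m ≠ k) (hm' : m ≠ k + 1) :
    0 < ⟪R.corner m - R.corner k, R.inward k⟫ := by
  have hpos : 0 < ⟪R.inward k, R.inward k⟫ := by
    rw [real_inner_self_eq_norm_sq]
    have : R.inward k ≠ 0 := by
      rw [inward_eq]; exact sub_ne_zero.2 (R.corner_add_three_ne k)
    positivity
  have hm2 : m = k + 2 ∨ m = k + 3 := by
    revert hm hm'; clear * -; revert k m; decide
  rcases hm2 with rfl | rfl
  · have : R.corner (k + 2) - R.corner k = R.inward k + (R.corner (k + 1) - R.corner k) := by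
      unfold inward; abel
    rw [this, inner_add_left]
    nth_rewrite 3 [inward_eq]
    rw [inner_side_inward]
    simpa using hpos
  · rw [← inward_eq]; exact hpos

theorem corner_injective : Function.Injective R.corner := by
  intro i j h
  by_contra hij
  by_cases hj : j = i + 1
  · exact R.corner_ne_corner_add_one i (hj ▸ h)
  · have := R.inner_inward_corner i j (Ne.symm hij) hj
    rw [h, sub_self, inner_zero_left] at this
    exact lt_irrefl _ this

theorem eq_of_corner_mem_segment {m k : Fin 4}
    (h : R.corner m ∈ segment ℝ (R.corner k) (R.corner (k + 1))) : m = k ∨ m = k + 1 := by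
  by_contra! hm
  have hpos := R.inner_inward_corner k m hm.1 hm.2
  rw [segment_eq_image'] at h
  obtain ⟨θ, -, hθ⟩ := h
  have h0 : ⟪R.corner (k + 1) - R.corner k, R.inward k⟫ = 0 := by
    rw [inward_eq]; exact R.inner_side_inward k
  simp only at hθ
  rw [← hθ, add_sub_cancel_left, inner_smul_left, h0, mul_zero] at hpos
  exact lt_irrefl _ hpos

theorem corner_mem_region (k : Fin 4) : R.corner k ∈ R.region :=
  subset_convexHull ℝ _ ⟨k, rfl⟩

theorem isClosed_region : IsClosed R.region :=
  ((Set.finite_range R.corner).isCompact_convexHull ℝ).isClosed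

/-- The other end of a side at the corner `k`: the next corner if `s` is true, the previous one
otherwise. -/
def next (k : Fin 4) (s : Bool) : Fin 4 := if s then k + 1 else k + 3

theorem next_next (k : Fin 4) (s : Bool) : next (next k s) (!s) = k := by
  revert k s; decide

theorem corner_next_ne (k : Fin 4) (s : Bool) : R.corner (next k s) ≠ R.corner k := by
  cases s
  · exact R.corner_add_three_ne k
  · exact (R.corner_ne_corner_add_one k).symm

/-- The sides of a rectangle are parallel to the first two vectors of an orthonormal basis. -/
theorem exists_basis : ∃ b : OrthonormalBasis (Fin 3) ℝ E3, ∀ k s, ∃ r : ℝ, 0 < r ∧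
    ∃ j, R.corner (next k s) - R.corner k = r • b j ∨
      R.corner (next k s) - R.corner k = r • -b j := by
  have ha : R.corner 1 - R.corner 0 ≠ 0 := sub_ne_zero.2 R.ne_01.symm
  have hd : R.corner 3 - R.corner 0 ≠ 0 := sub_ne_zero.2 R.ne_03.symm
  have hort := R.right_angle
  have h2 := R.corner_two
  set a := R.corner 1 - R.corner 0 with hadef
  set d := R.corner 3 - R.corner 0 with hddef
  let v : Fin 3 → E3 := ![‖a‖⁻¹ • a, ‖d‖⁻¹ • d, 0]
  have hv : Orthonormal ℝ (({0, 1} : Set (Fin 3)).domRestrict v) := by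
    have hort' : ⟪d, a⟫ = 0 := by rwa [real_inner_comm]
    refine ⟨?_, ?_⟩
    · rintro ⟨i, rfl | rfl⟩
      · exact norm_smul_inv_norm ha
      · exact norm_smul_inv_norm hd
    · rintro ⟨i, rfl | rfl⟩ ⟨j, rfl | rfl⟩ hij
      · exact absurd rfl hij
      · show ⟪‖a‖⁻¹ • a, ‖d‖⁻¹ • d⟫ = 0
        rw [inner_smul_left, inner_smul_right, hort, mul_zero, mul_zero]
      · show ⟪‖d‖⁻¹ • d, ‖a‖⁻¹ • a⟫ = 0
        rw [inner_smul_left, inner_smul_right, hort', mul_zero, mul_zero]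
      · exact absurd rfl hij
  obtain ⟨b, hb⟩ := hv.exists_orthonormalBasis_extension_of_card_eq (by simp)
  have hb0 : a = ‖a‖ • b 0 := by
    rw [hb 0 (by simp)]
    simp [v, smul_smul, mul_inv_cancel₀ (norm_ne_zero_iff.2 ha)]
  have hb1 : d = ‖d‖ • b 1 := by
    rw [hb 1 (by simp)]
    simp [v, smul_smul, mul_inv_cancel₀ (norm_ne_zero_iff.2 hd)]
  have hpa : 0 < ‖a‖ := norm_pos_iff.2 ha
  have hpd : 0 < ‖d‖ := norm_pos_iff.2 hd
  have c1 : R.corner 1 = R.corner 0 + a := by rw [hadef]; abel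
  have c3 : R.corner 3 = R.corner 0 + d := by rw [hddef]; abel
  have c2 : R.corner 2 = R.corner 0 + a + d := by rw [h2, hadef, hddef]; abel
  have posa : ∀ {z : E3}, z = a → ∃ r : ℝ, 0 < r ∧ ∃ j, z = r • b j ∨ z = r • -b j :=
    fun h => ⟨‖a‖, hpa, 0, Or.inl (h.trans hb0)⟩
  have nega : ∀ {z : E3}, z = -a → ∃ r : ℝ, 0 < r ∧ ∃ j, z = r • b j ∨ z = r • -b j :=
    fun h => ⟨‖a‖, hpa, 0, Or.inr (by rw [h, smul_neg, ← hb0])⟩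
  have posd : ∀ {z : E3}, z = d → ∃ r : ℝ, 0 < r ∧ ∃ j, z = r • b j ∨ z = r • -b j :=
    fun h => ⟨‖d‖, hpd, 1, Or.inl (h.trans hb1)⟩
  have negd : ∀ {z : E3}, z = -d → ∃ r : ℝ, 0 < r ∧ ∃ j, z = r • b j ∨ z = r • -b j :=
    fun h => ⟨‖d‖, hpd, 1, Or.inr (by rw [h, smul_neg, ← hb1])⟩
  refine ⟨b, fun k s => ?_⟩
  fin_cases k <;> cases s
  · exact posd rfl
  · exact posa rfl
  · exact nega (show R.corner 0 - R.corner 1 = -a by rw [c1]; abel)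
  · exact posd (show R.corner 2 - R.corner 1 = d by rw [c1, c2]; abel)
  · exact negd (show R.corner 1 - R.corner 2 = -d by rw [c1, c2]; abel)
  · exact nega (show R.corner 3 - R.corner 2 = -a by rw [c3, c2]; abel)
  · exact posa (show R.corner 2 - R.corner 3 = a by rw [c3, c2]; abel)
  · exact negd (show R.corner 0 - R.corner 3 = -d by rw [c3]; abel)

/-- The frame of a rectangle: the unit vectors along its sides and its two unit normals. It is
written in terms of a chosen basis along the sides, but as a set it does not depend on the
choice. -/
noncomputable def frame : Set E3 :=
  {u | ∃ k, u = R.exists_basis.choose k ∨ u = -R.exists_basis.choose k}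

theorem isFrame_frame : IsFrame R.frame := ⟨R.exists_basis.choose, rfl⟩

/-- The unit vector from the corner `k` along a side. -/
noncomputable def dir (k : Fin 4) (s : Bool) : E3 :=
  ‖R.corner (next k s) - R.corner k‖⁻¹ • (R.corner (next k s) - R.corner k)

theorem dir_mem_frame (k : Fin 4) (s : Bool) : R.dir k s ∈ R.frame := by
  obtain ⟨r, hr, j, h | h⟩ := R.exists_basis.choose_spec k s
  · refine ⟨j, Or.inl ?_⟩
    rw [dir, h]
    exact inv_norm_smul_pos_smul (by simp) hr
  · refine ⟨j, Or.inr ?_⟩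
    rw [dir, h]
    exact inv_norm_smul_pos_smul (by simp) hr

theorem inner_dir_not (k : Fin 4) (s : Bool) : ⟪R.dir k s, R.dir k (!s)⟫ = 0 := by
  have h := R.inner_side_inward k
  have h' := h
  rw [real_inner_comm] at h'
  cases s <;> simp [dir, next, inner_smul_left, inner_smul_right, h, h']

/-- The inward vectors of two rectangles with the same frame are parallel or perpendicular. -/
theorem angle_eq_mul_pi_div_two {R' : Rectangle} (h : R.frame = R'.frame) (k l : Fin 4) :
    ∃ m : ℤ, InnerProductGeometry.angle (R.inward k) (R'.inward l) = m * (Real.pi / 2) := by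
  have key : ∀ (Q : Rectangle) (k : Fin 4), ∃ r : ℝ, 0 < r ∧
      r • Q.inward k ∈ Q.frame := fun Q k => by
    have hne : Q.corner (next k false) - Q.corner k ≠ 0 :=
      sub_ne_zero.2 (Q.corner_next_ne k false)
    refine ⟨‖Q.corner (next k false) - Q.corner k‖⁻¹, by positivity, ?_⟩
    rw [inward_eq]
    exact Q.dir_mem_frame k false
  obtain ⟨r, hr, hm⟩ := key R k
  obtain ⟨r', hr', hm'⟩ := key R' l
  rw [← InnerProductGeometry.angle_smul_left_of_pos _ _ hr,
    ← InnerProductGeometry.angle_smul_right_of_pos _ _ hr']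
  rw [← h] at hm'
  have hne : r' • R'.inward l ≠ 0 := by
    intro h0
    have := R.isFrame_frame.norm_eq_one hm'
    rw [h0, norm_zero] at this
    exact zero_ne_one this
  rcases R.isFrame_frame.eq_or_eq_neg_or_inner hm hm' with e | e | e
  · exact ⟨0, by rw [e, InnerProductGeometry.angle_self hne]; simp⟩
  · exact ⟨2, by rw [e, InnerProductGeometry.angle_neg_self_of_nonzero hne]; push_cast; ring⟩
  · exact ⟨1, by rw [InnerProductGeometry.inner_eq_zero_iff_angle_eq_pi_div_two _ _ |>.1 e]; simp⟩

end Rectangle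

/-! ### Flags of a rectangular polyhedron -/

/-- A flag of a family of rectangles: a face, a corner of it, and one of the two sides at that
corner (the one to the next corner if the Boolean is true, to the previous one otherwise). -/
abbrev RectangleFlag (ι : Type*) : Type _ := ι × Fin 4 × Bool

namespace RectangularPolyhedron

variable {ι : Type*} (P : RectangularPolyhedron ι)

/-- The vertex of a flag. -/
def vert (f : RectangleFlag ι) : E3 := (P.face f.1).corner f.2.1

/-- The other end of the edge of a flag. -/
def tip (f : RectangleFlag ι) : E3 := (P.face f.1).corner (Rectangle.next f.2.1 f.2.2)

/-- The edge of a flag. -/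
def edge (f : RectangleFlag ι) : Sym2 E3 := s(P.vert f, P.tip f)

/-- The unit vector along the edge of a flag, pointing away from its vertex. -/
noncomputable def dir (f : RectangleFlag ι) : E3 := (P.face f.1).dir f.2.1 f.2.2

/-- The frame of the face of a flag. -/
noncomputable def frame (f : RectangleFlag ι) : Set E3 := (P.face f.1).frame

/-- The flag with the same face and edge, at the other end of the edge. -/
def reverse (f : RectangleFlag ι) : RectangleFlag ι :=
  (f.1, Rectangle.next f.2.1 f.2.2, !f.2.2)

/-- The flag with the same face and vertex, with the other side of the face at that vertex. -/
def turn (f : RectangleFlag ι) : RectangleFlag ι := (f.1, f.2.1, !f.2.2)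

theorem reverse_reverse (f : RectangleFlag ι) : reverse (reverse f) = f := by
  simp [reverse, Rectangle.next_next]

theorem turn_turn (f : RectangleFlag ι) : turn (turn f) = f := by simp [turn]

theorem turn_ne (f : RectangleFlag ι) : turn f ≠ f := fun h => by
  have := congrArg (fun g : RectangleFlag ι => g.2.2) h
  simp [turn] at this

theorem vert_reverse (f : RectangleFlag ι) : P.vert (reverse f) = P.tip f := rfl

theorem tip_reverse (f : RectangleFlag ι) : P.tip (reverse f) = P.vert f := by
  simp [tip, vert, reverse, Rectangle.next_next]

theorem tip_ne_vert (f : RectangleFlag ι) : P.tip f ≠ P.vert f :=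
  (P.face f.1).corner_next_ne _ _

theorem dir_eq (f : RectangleFlag ι) :
    P.dir f = ‖P.tip f - P.vert f‖⁻¹ • (P.tip f - P.vert f) := rfl

theorem edge_length_pos (f : RectangleFlag ι) : 0 < ‖P.tip f - P.vert f‖ :=
  norm_pos_iff.2 (sub_ne_zero.2 (P.tip_ne_vert f))

theorem tip_sub_vert (f : RectangleFlag ι) :
    P.tip f - P.vert f = ‖P.tip f - P.vert f‖ • P.dir f := by
  rw [dir_eq, smul_smul, mul_inv_cancel₀ (P.edge_length_pos f).ne', one_smul]

theorem dir_reverse (f : RectangleFlag ι) : P.dir (reverse f) = -P.dir f := by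
  rw [dir_eq, dir_eq, vert_reverse, tip_reverse, ← smul_neg, neg_sub, norm_sub_rev]

theorem dir_mem_frame (f : RectangleFlag ι) : P.dir f ∈ P.frame f :=
  (P.face f.1).dir_mem_frame _ _

theorem edge_mem_sides (f : RectangleFlag ι) : P.edge f ∈ (P.face f.1).sides := by
  obtain ⟨i, k, _ | _⟩ := f
  · refine ⟨k + 3, ?_⟩
    have : k + 3 + 1 = k := by revert k; decide
    simp only [Rectangle.side, this]
    exact Sym2.eq_swap
  · exact ⟨k, rfl⟩

theorem exists_flag {i : ι} {v w : E3} (h : s(v, w) ∈ (P.face i).sides) :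
    ∃ f : RectangleFlag ι, f.1 = i ∧ P.vert f = v ∧ P.tip f = w := by
  obtain ⟨k, hk⟩ := h
  rcases Sym2.eq_iff.1 hk with ⟨h1, h2⟩ | ⟨h1, h2⟩
  · exact ⟨(i, k, true), rfl, h1, h2⟩
  · refine ⟨reverse (i, k, true), rfl, h2, ?_⟩
    rw [tip_reverse]
    exact h1

theorem flag_ext {f g : RectangleFlag ι} (h1 : f.1 = g.1) (h2 : P.vert f = P.vert g)
    (h3 : P.tip f = P.tip g) : f = g := by
  obtain ⟨i, k, s⟩ := f
  obtain ⟨j, l, s'⟩ := g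
  obtain rfl : i = j := h1
  obtain rfl : k = l := (P.face i).corner_injective h2
  have h := (P.face i).corner_injective h3
  have : s = s' := by
    have h' : Rectangle.next k s = Rectangle.next k s' := h
    revert h'; clear * -; revert k s s'; decide
  rw [this]

/-- Every edge lies on exactly two faces, so there is a flag on the other side of the edge. -/
theorem exists_across (f : RectangleFlag ι) : ∃ g : RectangleFlag ι,
    g.1 ≠ f.1 ∧ P.vert g = P.vert f ∧ P.tip g = P.tip f := by
  have h := P.edge_two_faces f.1 _ (P.edge_mem_sides f)
  obtain ⟨j, hj, hne⟩ := Set.exists_ne_of_one_lt_ncard (h ▸ one_lt_two) f.1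
  obtain ⟨g, rfl, hg⟩ := P.exists_flag hj
  exact ⟨g, hne, hg⟩

/-- The flag with the same vertex and edge, in the other face on that edge. -/
noncomputable def across (f : RectangleFlag ι) : RectangleFlag ι := (P.exists_across f).choose

theorem across_face_ne (f : RectangleFlag ι) : (P.across f).1 ≠ f.1 :=
  (P.exists_across f).choose_spec.1

theorem vert_across (f : RectangleFlag ι) : P.vert (P.across f) = P.vert f :=
  (P.exists_across f).choose_spec.2.1

theorem tip_across (f : RectangleFlag ι) : P.tip (P.across f) = P.tip f :=
  (P.exists_across f).choose_spec.2.2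

theorem edge_across (f : RectangleFlag ι) : P.edge (P.across f) = P.edge f := by
  rw [edge, vert_across, tip_across, edge]

theorem dir_across (f : RectangleFlag ι) : P.dir (P.across f) = P.dir f := by
  rw [dir_eq, dir_eq, vert_across, tip_across]

theorem face_eq_or_of_edge_mem {f : RectangleFlag ι} {j : ι} (h : P.edge f ∈ (P.face j).sides) :
    j = f.1 ∨ j = (P.across f).1 := by
  have h2 := P.edge_two_faces f.1 _ (P.edge_mem_sides f)
  obtain ⟨x, y, hxy, hS⟩ := Set.ncard_eq_two.1 h2
  have hj : j ∈ ({x, y} : Set ι) := hS ▸ h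
  have hf : f.1 ∈ ({x, y} : Set ι) := hS ▸ P.edge_mem_sides f
  have ha : (P.across f).1 ∈ ({x, y} : Set ι) := hS ▸ (P.edge_across f ▸ P.edge_mem_sides _)
  have hne := P.across_face_ne f
  simp only [Set.mem_insert_iff, Set.mem_singleton_iff] at hj hf ha
  grind

theorem eq_or_eq_across {f g : RectangleFlag ι} (hv : P.vert g = P.vert f)
    (ht : P.tip g = P.tip f) : g = f ∨ g = P.across f := by
  have he : P.edge f ∈ (P.face g.1).sides := by
    have := P.edge_mem_sides g
    rwa [edge, hv, ht] at this
  rcases P.face_eq_or_of_edge_mem he with h | h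
  · exact Or.inl (P.flag_ext h hv ht)
  · exact Or.inr (P.flag_ext h (hv.trans (P.vert_across f).symm) (ht.trans (P.tip_across f).symm))

theorem across_ne (f : RectangleFlag ι) : P.across f ≠ f :=
  fun h => P.across_face_ne f (congrArg Prod.fst h)

theorem across_across (f : RectangleFlag ι) : P.across (P.across f) = f := by
  rcases P.eq_or_eq_across (f := f) (g := P.across (P.across f))
    (by rw [vert_across, vert_across]) (by rw [tip_across, tip_across]) with h | h
  · exact h
  · exact absurd h (P.across_ne _)

theorem across_reverse (f : RectangleFlag ι) : P.across (reverse f) = reverse (P.across f) := by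
  rcases P.eq_or_eq_across (f := reverse f) (g := reverse (P.across f))
    (by rw [vert_reverse, vert_reverse, tip_across])
    (by rw [tip_reverse, tip_reverse, vert_across]) with h | h
  · exact absurd (congrArg Prod.fst h) (P.across_face_ne f)
  · exact h.symm

theorem eq_of_edge_eq {f g : RectangleFlag ι} (h : P.edge g = P.edge f) :
    g = f ∨ g = reverse f ∨ g = P.across f ∨ g = reverse (P.across f) := by
  rcases Sym2.eq_iff.1 h with ⟨h1, h2⟩ | ⟨h1, h2⟩
  · rcases P.eq_or_eq_across h1 h2 with h | h <;> simp [h]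
  · rcases P.eq_or_eq_across (f := reverse f) (g := g) (h1.trans (P.vert_reverse f).symm)
      (h2.trans (P.tip_reverse f).symm) with h | h
    · simp [h]
    · rw [across_reverse] at h
      simp [h]

/-! ### Edges at a vertex have different directions -/

theorem eq_of_face_eq_of_dir_eq {f g : RectangleFlag ι} (hi : f.1 = g.1)
    (hv : P.vert f = P.vert g) (hd : P.dir f = P.dir g) : f = g := by
  obtain ⟨i, k, s⟩ := f
  obtain ⟨j, l, s'⟩ := g
  obtain rfl : i = j := hi
  obtain rfl : k = l := (P.face i).corner_injective hv
  by_cases h : s' = s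
  · rw [h]
  · obtain rfl : s' = !s := by revert h; clear * -; revert s s'; decide
    have h0 := (P.face i).inner_dir_not k s
    have hd' : (P.face i).dir k s = (P.face i).dir k (!s) := hd
    have h1 := (P.face i).isFrame_frame.norm_eq_one ((P.face i).dir_mem_frame k s)
    rw [← hd', real_inner_self_eq_norm_sq, h1] at h0
    norm_num at h0

theorem tip_mem_segment {f g : RectangleFlag ι} (hv : P.vert f = P.vert g)
    (hd : P.dir f = P.dir g) (hle : ‖P.tip f - P.vert f‖ ≤ ‖P.tip g - P.vert g‖) :
    P.tip f ∈ segment ℝ (P.vert g) (P.tip g) := by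
  rw [segment_eq_image']
  have hg := P.edge_length_pos g
  refine ⟨‖P.tip f - P.vert f‖ / ‖P.tip g - P.vert g‖,
    ⟨by positivity, (div_le_one hg).2 hle⟩, ?_⟩
  simp only
  have hsub : ∀ r : ℝ, (r / ‖P.tip g - P.vert g‖) • (P.tip g - P.vert g) = r • P.dir g := by
    intro r
    rw [dir_eq, smul_smul, div_eq_mul_inv]
  rw [hsub, ← hd, ← tip_sub_vert, ← hv]
  abel

/-- Two edges leaving a vertex in the same direction coincide: otherwise the shorter one would be
common to two faces without being a side of both. -/
theorem tip_eq_of_dir_eq {f g : RectangleFlag ι} (hv : P.vert f = P.vert g)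
    (hd : P.dir f = P.dir g) : P.tip f = P.tip g := by
  wlog hle : ‖P.tip f - P.vert f‖ ≤ ‖P.tip g - P.vert g‖ generalizing f g
  · exact (this hv.symm hd.symm (le_of_not_ge hle)).symm
  by_cases hi : f.1 = g.1
  · rw [P.eq_of_face_eq_of_dir_eq hi hv hd]
  have hseg := P.tip_mem_segment hv hd hle
  have hvi : P.vert f ∈ (P.face f.1).region ∩ (P.face g.1).region :=
    ⟨(P.face f.1).corner_mem_region _, hv ▸ (P.face g.1).corner_mem_region _⟩
  have hti : P.tip f ∈ (P.face f.1).region ∩ (P.face g.1).region :=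
    ⟨(P.face f.1).corner_mem_region _, (convex_convexHull ℝ _).segment_subset
      ((P.face g.1).corner_mem_region _) ((P.face g.1).corner_mem_region _) hseg⟩
  rcases P.face_inter f.1 g.1 hi with h | ⟨v, -, -, h⟩ | ⟨a, b, ha, hb, h⟩
  · rw [h] at hvi; exact hvi.elim
  · rw [h] at hvi hti
    exact absurd (hti.trans hvi.symm) (P.tip_ne_vert f)
  · rw [h] at hvi hti
    have hend : ∀ m, (P.face f.1).corner m ∈ segment ℝ a b →
        (P.face f.1).corner m = a ∨ (P.face f.1).corner m = b := by
      intro m hm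
      obtain ⟨k, hk⟩ := ha
      rcases Sym2.eq_iff.1 hk with ⟨h1, h2⟩ | ⟨h1, h2⟩
      · rw [← h1, ← h2] at hm ⊢
        rcases (P.face f.1).eq_of_corner_mem_segment hm with rfl | rfl <;> simp
      · rw [← h1, ← h2] at hm ⊢
        rw [segment_symm] at hm
        rcases (P.face f.1).eq_of_corner_mem_segment hm with rfl | rfl <;> simp
    have hv' : P.vert f = a ∨ P.vert f = b := hend _ hvi
    have ht' : P.tip f = a ∨ P.tip f = b := hend _ hti
    have hne := P.tip_ne_vert f
    have hs : s(P.vert f, P.tip f) = s(a, b) := by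
      rw [Sym2.eq_iff]
      grind
    rw [← hs] at hb
    obtain ⟨g', hg1, hg2, hg3⟩ := P.exists_flag hb
    have hd' : P.dir g' = P.dir g := by rw [← hd, dir_eq, dir_eq, hg2, hg3]
    rw [← P.eq_of_face_eq_of_dir_eq hg1 (hg2.trans hv) hd', hg3]

/-! ### Connectedness -/

theorem exists_common_corner {i j : ι}
    (h : ((P.face i).region ∩ (P.face j).region).Nonempty) :
    ∃ v, v ∈ (P.face i).corners ∧ v ∈ (P.face j).corners := by
  by_cases hij : i = j
  · subst hij
    exact ⟨_, ⟨0, rfl⟩, ⟨0, rfl⟩⟩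
  rcases P.face_inter i j hij with h' | ⟨v, h1, h2, -⟩ | ⟨a, b, ha, hb, -⟩
  · rw [h'] at h; exact absurd h Set.not_nonempty_empty
  · exact ⟨v, h1, h2⟩
  · obtain ⟨f, rfl, rfl, -⟩ := P.exists_flag ha
    obtain ⟨g, rfl, hg, -⟩ := P.exists_flag hb
    exact ⟨_, ⟨f.2.1, rfl⟩, ⟨g.2.1, hg⟩⟩

/-- A property of faces that passes to all faces with a common vertex holds for all faces. -/
theorem forall_of_common_corner [Finite ι] {Q : ι → Prop}
    (hQ : ∀ i j v, v ∈ (P.face i).corners → v ∈ (P.face j).corners → Q i → Q j)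
    {i : ι} (hi : Q i) (j : ι) : Q j := by
  by_contra hj
  have hcl : ∀ s : Set ι, IsClosed (⋃ k ∈ s, (P.face k).region) := fun s =>
    (Set.toFinite s).isClosed_biUnion fun k _ => (P.face k).isClosed_region
  obtain ⟨x, -, hx1, hx2⟩ := isPreconnected_closed_iff.1 P.connected.isPreconnected _ _
    (hcl {k | Q k}) (hcl {k | ¬ Q k})
    (fun x hx => by
      obtain ⟨k, hk⟩ := Set.mem_iUnion.1 hx
      by_cases h : Q k
      · exact Or.inl (Set.mem_biUnion (show k ∈ {k | Q k} from h) hk)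
      · exact Or.inr (Set.mem_biUnion (show k ∈ {k | ¬ Q k} from h) hk))
    ⟨_, Set.mem_iUnion.2 ⟨i, (P.face i).corner_mem_region 0⟩,
      Set.mem_biUnion (show i ∈ {k | Q k} from hi) ((P.face i).corner_mem_region 0)⟩
    ⟨_, Set.mem_iUnion.2 ⟨j, (P.face j).corner_mem_region 0⟩,
      Set.mem_biUnion (show j ∈ {k | ¬ Q k} from hj) ((P.face j).corner_mem_region 0)⟩
  simp only [Set.mem_iUnion, Set.mem_ofPred_eq] at hx1 hx2
  obtain ⟨k, hk, hxk⟩ := hx1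
  obtain ⟨l, hl, hxl⟩ := hx2
  obtain ⟨v, hv1, hv2⟩ := P.exists_common_corner ⟨x, hxk, hxl⟩
  exact hl (hQ k l v hv1 hv2 hk)

/-- A property of faces that passes across edges passes to all faces at a vertex, as the link of
the vertex is connected. -/
theorem of_common_corner_of_across {Q : ι → Prop}
    (hQ : ∀ f : RectangleFlag ι, Q f.1 → Q (P.across f).1) {i j : ι} {v : E3}
    (hi : v ∈ (P.face i).corners) (hj : v ∈ (P.face j).corners) (h : Q i) : Q j := by
  have hedge : ∀ {w : E3} {k l : ι}, s(v, w) ∈ (P.face k).sides → s(v, w) ∈ (P.face l).sides →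
      Q k → Q l := by
    intro w k l hk hl h
    obtain ⟨f, rfl, hv, hw⟩ := P.exists_flag hk
    rw [← hv, ← hw] at hl
    rcases P.face_eq_or_of_edge_mem hl with rfl | rfl
    · exact h
    · exact hQ f h
  obtain ⟨n, -, ⟨φ⟩⟩ := P.link_cycle i v hi
  have hpre : (rectangleLink P.face v).Preconnected :=
    φ.preconnected_iff.2 SimpleGraph.cycleGraph_preconnected
  have hstart : ∀ {k : ι}, v ∈ (P.face k).corners → ∃ w, s(v, w) ∈ (P.face k).sides := by
    rintro k ⟨m, rfl⟩
    exact ⟨_, ⟨m, rfl⟩⟩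
  obtain ⟨w, hw⟩ := hstart hi
  obtain ⟨w', hw'⟩ := hstart hj
  have key : ∀ x, Relation.ReflTransGen (rectangleLink P.face v).Adj ⟨w, i, hw⟩ x →
      ∀ k, s(v, x.1) ∈ (P.face k).sides → Q k := by
    intro x hx
    induction hx with
    | refl => exact fun k hk => hedge hw hk h
    | tail _ hadj ih =>
      obtain ⟨-, m, hm1, hm2⟩ := hadj
      exact fun k hk => hedge hm2 hk (ih m hm1)
  exact key ⟨w', j, hw'⟩ ((SimpleGraph.reachable_iff_reflTransGen _ _).1 (hpre _ _)) j hw'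

theorem forall_of_across [Finite ι] {Q : ι → Prop}
    (hQ : ∀ f : RectangleFlag ι, Q f.1 → Q (P.across f).1) {i : ι} (hi : Q i) (j : ι) : Q j :=
  P.forall_of_common_corner (fun _ _ _ h1 h2 => P.of_common_corner_of_across hQ h1 h2) hi j

/-- A property of vertices that passes along edges holds for all vertices. -/
theorem forall_vert_of_edge [Finite ι] {Q : E3 → Prop}
    (hQ : ∀ f, Q (P.vert f) → Q (P.tip f)) {f : RectangleFlag ι} (hf : Q (P.vert f))
    (g : RectangleFlag ι) : Q (P.vert g) := by
  have hface : ∀ (i : ι) (k l : Fin 4), Q ((P.face i).corner k) → Q ((P.face i).corner l) := by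
    intro i k l h
    have h1 : Q ((P.face i).corner (k + 1)) := hQ (i, k, true) h
    have h2 : Q ((P.face i).corner (k + 1 + 1)) := hQ (i, k + 1, true) h1
    have h3 : Q ((P.face i).corner (k + 1 + 1 + 1)) := hQ (i, k + 1 + 1, true) h2
    have : l = k ∨ l = k + 1 ∨ l = k + 1 + 1 ∨ l = k + 1 + 1 + 1 := by
      clear * -; revert k l; decide
    rcases this with rfl | rfl | rfl | rfl <;> assumption
  refine P.forall_of_common_corner (Q := fun i => ∀ k, Q ((P.face i).corner k)) ?_
    (i := f.1) (fun k => hface _ _ _ hf) g.1 g.2.1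
  rintro i j v ⟨k, hk⟩ ⟨l, hl⟩ hi m
  exact hface j l m (by rw [hl, ← hk]; exact hi k)

end RectangularPolyhedron

/-! ### Bent edges and regions -/

namespace RectangularPolyhedron

variable {ι : Type*} (P : RectangularPolyhedron ι)

/-- The edge of the flag is bent: its two faces have different frames. For rectangular faces this
means that the dihedral angle is not a multiple of `π / 2`. -/
def Bent (f : RectangleFlag ι) : Prop := P.frame (P.across f) ≠ P.frame f

theorem bent_across (f : RectangleFlag ι) : P.Bent (P.across f) ↔ P.Bent f := by
  rw [Bent, across_across, Bent]
  exact ne_comm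

theorem bent_reverse (f : RectangleFlag ι) : P.Bent (reverse f) ↔ P.Bent f := by
  rw [Bent, across_reverse]
  rfl

theorem bent_of_edge_eq {f g : RectangleFlag ι} (h : P.edge g = P.edge f) (hf : P.Bent f) :
    P.Bent g := by
  rcases P.eq_of_edge_eq h with rfl | rfl | rfl | rfl
  · exact hf
  · exact (P.bent_reverse f).2 hf
  · exact (P.bent_across f).2 hf
  · exact (P.bent_reverse _).2 ((P.bent_across f).2 hf)

/-- Two faces are neighbours across an edge that is not bent. -/
def FaceAdj (i j : ι) : Prop := ∃ f : RectangleFlag ι, ¬ P.Bent f ∧ f.1 = i ∧ (P.across f).1 = j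

/-- The regions of the surface cut along its bent edges. -/
def Region : Type _ := Quot P.FaceAdj

instance [Finite ι] : Finite P.Region := inferInstanceAs (Finite (Quot P.FaceAdj))

/-- The region containing the face of a flag. -/
def regionOf (f : RectangleFlag ι) : P.Region := Quot.mk _ f.1

/-- The common frame of the faces of a region. -/
noncomputable def regionFrame : P.Region → Set E3 :=
  Quot.lift (fun i => (P.face i).frame) (by
    rintro i j ⟨f, hf, rfl, rfl⟩
    exact (not_not.1 hf).symm)

theorem frame_eq_regionFrame (f : RectangleFlag ι) : P.frame f = P.regionFrame (P.regionOf f) := rfl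

theorem regionOf_across {f : RectangleFlag ι} (h : ¬ P.Bent f) :
    P.regionOf (P.across f) = P.regionOf f :=
  (Quot.sound ⟨f, h, rfl, rfl⟩).symm

/-- Two distinct sides of bent edges with the same vertex and region have different directions,
since the two sides of one bent edge have different frames. -/
theorem dir_ne_of_region_eq {P : RectangularPolyhedron ι}
    {c : {f // P.Bent f} → {f // P.Bent f}} (hne : ∀ a, c a ≠ a)
    (hv : ∀ a, P.vert (c a).1 = P.vert a.1)
    (hr : ∀ a, P.regionOf (c a).1 = P.regionOf a.1) (a : {f // P.Bent f}) :
    P.dir (c a).1 ≠ P.dir a.1 := by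
  intro h
  rcases P.eq_or_eq_across (hv a) (P.tip_eq_of_dir_eq (hv a) h) with h' | h'
  · exact hne a (Subtype.ext h')
  · refine a.2 ?_
    rw [← h', frame_eq_regionFrame, hr, ← frame_eq_regionFrame]

variable [Fintype ι]

/-- At every vertex, every region has an even number of sides of bent edges: the sides come in
pairs around the corners of faces, and those that are not bent also come in pairs across edges. -/
theorem even_card_bent (b : E3 × P.Region) :
    Even (Nat.card {a : {f // P.Bent f} // (P.vert a.1, P.regionOf a.1) = b}) := by
  classical
  obtain ⟨v, q⟩ := b
  let S : Finset (RectangleFlag ι) :=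
    Finset.univ.filter fun f => (P.vert f, P.regionOf f) = (v, q)
  have hS : Even S.card := even_card_of_involution S turn
    (fun f hf => by
      rw [Finset.mem_filter] at hf ⊢
      exact ⟨Finset.mem_univ _, hf.2⟩)
    (fun f _ => turn_turn f) (fun f _ => turn_ne f)
  have hS' : Even (S.filter fun f => ¬ P.Bent f).card :=
    even_card_of_involution _ P.across
    (fun f hf => by
      simp only [S, Finset.mem_filter, Finset.mem_univ, true_and] at hf ⊢
      rw [vert_across, P.regionOf_across hf.2, bent_across]
      exact hf)
    (fun f _ => P.across_across f) (fun f _ => P.across_ne f)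
  have hsum := Finset.card_filter_add_card_filter_not (s := S) P.Bent
  rw [← hsum, Nat.even_add] at hS
  have hcard : Nat.card {a : {f // P.Bent f} // (P.vert a.1, P.regionOf a.1) = (v, q)} =
      (S.filter P.Bent).card := by
    rw [Nat.card_congr (Equiv.subtypeSubtypeEquivSubtypeInter P.Bent
      (fun f => (P.vert f, P.regionOf f) = (v, q))), Nat.card_eq_fintype_card,
      Fintype.card_subtype]
    congr 1
    ext f
    simp [S, and_comm]
  rw [hcard]
  exact hS.2 hS'

/-- The set of vertices on bent edges. -/
noncomputable def bentVertices : Finset E3 := by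
  classical exact (Finset.univ.filter P.Bent).image P.vert

/-- The set of bent edges. -/
noncomputable def bentEdges : Finset (Sym2 E3) := by
  classical exact (Finset.univ.filter P.Bent).image P.edge

/-- The set of edges that are not bent. -/
noncomputable def flatEdges : Finset (Sym2 E3) := by
  classical exact (Finset.univ.filter fun f => ¬ P.Bent f).image P.edge

/-- The set of vertices on no bent edge. -/
noncomputable def flatVertices : Finset E3 := by
  classical exact Finset.univ.image P.vert \ P.bentVertices

theorem mem_bentVertices {v : E3} : v ∈ P.bentVertices ↔ ∃ f, P.Bent f ∧ P.vert f = v := by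
  classical simp [bentVertices]

theorem mem_flatEdges {e : Sym2 E3} : e ∈ P.flatEdges ↔ ∃ f, ¬ P.Bent f ∧ P.edge f = e := by
  classical
  unfold flatEdges
  simp only [Finset.mem_image, Finset.mem_filter, Finset.mem_univ, true_and]

theorem mem_flatVertices {v : E3} :
    v ∈ P.flatVertices ↔ (∃ f, P.vert f = v) ∧ v ∉ P.bentVertices := by
  classical
  unfold flatVertices
  simp only [Finset.mem_sdiff, Finset.mem_image, Finset.mem_univ, true_and]

/-! ### An Euler inequality for the graph of bent edges -/

/-- The incidence matrix modulo 2 of faces and edges that are not bent. -/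
noncomputable def faceMatrix : Matrix ι P.flatEdges (ZMod 2) := by
  classical exact Matrix.of fun i e => if e.1 ∈ (P.face i).sides then 1 else 0

/-- The incidence matrix modulo 2 of edges that are not bent and vertices on no bent edge. -/
noncomputable def vertexMatrix : Matrix P.flatEdges P.flatVertices (ZMod 2) := by
  classical exact Matrix.of fun e v => if v.1 ∈ e.1 then 1 else 0

theorem faceMatrix_mul_vertexMatrix : P.faceMatrix * P.vertexMatrix = 0 := by
  classical
  ext i v
  have hv := P.mem_flatVertices.1 v.2
  have hflat : ∀ f : RectangleFlag ι, P.vert f = v.1 → ¬ P.Bent f := fun f hf hb =>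
    hv.2 (P.mem_bentVertices.2 ⟨f, hb, hf⟩)
  let S : Finset (RectangleFlag ι) := Finset.univ.filter fun f => f.1 = i ∧ P.vert f = v.1
  have hS : Even S.card := even_card_of_involution S turn
    (fun f hf => by
      rw [Finset.mem_filter] at hf ⊢
      exact ⟨Finset.mem_univ _, hf.2⟩)
    (fun f _ => turn_turn f) (fun f _ => turn_ne f)
  have hmem : ∀ f, f ∈ S ↔ f.1 = i ∧ P.vert f = v.1 := fun f => by simp [S]
  have hcard : S.card = (Finset.univ.filter fun e : P.flatEdges =>
      e.1 ∈ (P.face i).sides ∧ v.1 ∈ e.1).card := by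
    refine Finset.card_bij
      (fun f hf => ⟨P.edge f, P.mem_flatEdges.2 ⟨f, hflat f ((hmem f).1 hf).2, rfl⟩⟩) ?_ ?_ ?_
    · intro f hf
      obtain ⟨rfl, hfv⟩ := (hmem f).1 hf
      refine Finset.mem_filter.2 ⟨Finset.mem_univ _, P.edge_mem_sides f, ?_⟩
      exact Sym2.mem_iff.2 (Or.inl hfv.symm)
    · intro f hf g hg h
      obtain ⟨hf1, hf2⟩ := (hmem f).1 hf
      obtain ⟨hg1, hg2⟩ := (hmem g).1 hg
      have h' : P.edge f = P.edge g := congrArg Subtype.val h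
      rw [edge, edge, hf2, hg2, Sym2.congr_right] at h'
      exact P.flag_ext (hf1.trans hg1.symm) (hf2.trans hg2.symm) h'
    · rintro ⟨e, he⟩ h
      obtain ⟨-, h1, h2⟩ := Finset.mem_filter.1 h
      obtain ⟨w, hw⟩ := h2
      have hw' : e = s(v.1, w) := hw
      subst hw'
      obtain ⟨f, hf1, hf2, hf3⟩ := P.exists_flag h1
      exact ⟨f, (hmem f).2 ⟨hf1, hf2⟩, Subtype.ext (show s(P.vert f, P.tip f) = _ by rw [hf2, hf3])⟩
  rw [Matrix.mul_apply]
  simp only [faceMatrix, vertexMatrix, Matrix.of_apply, Matrix.zero_apply, mul_ite, mul_one,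
    mul_zero]
  simp only [← ite_and]
  rw [Finset.sum_boole, ZMod.natCast_eq_zero_iff_even]
  have hcomm : (Finset.univ.filter fun e : P.flatEdges =>
      v.1 ∈ e.1 ∧ e.1 ∈ (P.face i).sides) = Finset.univ.filter fun e : P.flatEdges =>
      e.1 ∈ (P.face i).sides ∧ v.1 ∈ e.1 := Finset.filter_congr fun _ _ => and_comm
  rw [hcomm, ← hcard]
  exact hS

/-- A function on the faces that is orthogonal to all columns of the face matrix is constant on
regions, so the left kernel has at most the dimension of the functions on regions. -/
theorem card_le_rank_faceMatrix : Fintype.card ι ≤ P.faceMatrix.rank + Nat.card P.Region := by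
  classical
  have : Fintype P.Region := Fintype.ofFinite _
  rw [← Matrix.rank_transpose, Nat.card_eq_fintype_card]
  have h1 := P.faceMatrix.transpose.mulVecLin.finrank_range_add_finrank_ker
  rw [Module.finrank_fintype_fun_eq_card] at h1
  let L : (P.Region → ZMod 2) →ₗ[ZMod 2] (ι → ZMod 2) :=
    LinearMap.funLeft (ZMod 2) (ZMod 2) (Quot.mk P.FaceAdj)
  have hker : LinearMap.ker P.faceMatrix.transpose.mulVecLin ≤ LinearMap.range L := by
    intro g hg
    have hg' : P.faceMatrix.transpose.mulVec g = 0 := hg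
    refine ⟨Quot.lift g ?_, rfl⟩
    rintro _ _ ⟨f, hf, rfl, rfl⟩
    have h := congrFun hg' ⟨P.edge f, P.mem_flatEdges.2 ⟨f, hf, rfl⟩⟩
    simp only [Matrix.mulVec, dotProduct, Matrix.transpose_apply, faceMatrix, Matrix.of_apply,
      ite_mul, one_mul, zero_mul, Pi.zero_apply] at h
    rw [← Finset.sum_filter] at h
    have hpair : (Finset.univ.filter fun i => P.edge f ∈ (P.face i).sides) =
        {f.1, (P.across f).1} := by
      ext i
      simp only [Finset.mem_filter, Finset.mem_univ, true_and, Finset.mem_insert,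
        Finset.mem_singleton]
      refine ⟨P.face_eq_or_of_edge_mem, ?_⟩
      rintro (rfl | rfl)
      · exact P.edge_mem_sides f
      · exact P.edge_across f ▸ P.edge_mem_sides _
    rw [hpair, Finset.sum_pair (P.across_face_ne f).symm] at h
    exact CharTwo.add_eq_zero.1 h
  have h2 := (Submodule.finrank_mono hker).trans L.finrank_range_le
  rw [Module.finrank_fintype_fun_eq_card] at h2
  have h3 : P.faceMatrix.transpose.rank =
    Module.finrank (ZMod 2) (LinearMap.range P.faceMatrix.transpose.mulVecLin) := rfl
  omega

/-- A function on the flat vertices, extended by zero to the bent ones, that cancels on the ends of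
every edge is constant along edges, hence zero, because the surface is connected. -/
theorem rank_vertexMatrix {f₀ : RectangleFlag ι} (hf₀ : P.Bent f₀) :
    P.vertexMatrix.rank = P.flatVertices.card := by
  classical
  have hinj : Function.Injective P.vertexMatrix.mulVecLin := by
    rw [injective_iff_map_eq_zero]
    intro g hg
    have hg' : P.vertexMatrix.mulVec g = 0 := hg
    let G : E3 → ZMod 2 := fun v => if h : v ∈ P.flatVertices then g ⟨v, h⟩ else 0
    have hG : ∀ v, ∑ w : P.flatVertices, (if w.1 = v then g w else 0) = G v := by
      intro v
      by_cases hv : v ∈ P.flatVertices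
      · rw [Finset.sum_eq_single_of_mem ⟨v, hv⟩ (Finset.mem_univ _)
          (fun w _ hw => if_neg fun h => hw (Subtype.ext h))]
        simp [G, hv]
      · rw [Finset.sum_eq_zero fun w _ => if_neg fun (h : w.1 = v) => hv (h ▸ w.2)]
        simp [G, hv]
    have hbent : ∀ f, P.Bent f → G (P.vert f) = 0 := fun f hf =>
      dif_neg fun h => (P.mem_flatVertices.1 h).2 (P.mem_bentVertices.2 ⟨f, hf, rfl⟩)
    have hadd : ∀ f : RectangleFlag ι, G (P.vert f) + G (P.tip f) = 0 := by
      intro f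
      by_cases hf : P.Bent f
      · rw [hbent f hf, ← vert_reverse, hbent _ ((P.bent_reverse f).2 hf), add_zero]
      · have h := congrFun hg' ⟨P.edge f, P.mem_flatEdges.2 ⟨f, hf, rfl⟩⟩
        simp only [Matrix.mulVec, dotProduct, vertexMatrix, Matrix.of_apply,
          ite_mul, one_mul, zero_mul, Pi.zero_apply] at h
        rw [← hG, ← hG, ← Finset.sum_add_distrib]
        refine Eq.trans ?_ h
        refine Finset.sum_congr rfl fun w _ => ?_
        have hne := P.tip_ne_vert f
        have hmem : w.1 ∈ P.edge f ↔ w.1 = P.vert f ∨ w.1 = P.tip f := Sym2.mem_iff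
        by_cases h1 : w.1 = P.vert f
        · have h2 : w.1 ≠ P.tip f := fun h2 => hne (h2.symm.trans h1)
          rw [if_pos h1, if_neg h2, add_zero, if_pos (hmem.2 (Or.inl h1))]
        · by_cases h2 : w.1 = P.tip f
          · rw [if_neg h1, if_pos h2, zero_add, if_pos (hmem.2 (Or.inr h2))]
          · rw [if_neg h1, if_neg h2, add_zero, if_neg fun h' => (hmem.1 h').elim h1 h2]
    have hall := P.forall_vert_of_edge (Q := fun v => G v = 0)
      (fun f hf => by have := hadd f; rwa [hf, zero_add] at this) (hbent f₀ hf₀)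
    ext ⟨v, hv⟩
    obtain ⟨f, rfl⟩ := (P.mem_flatVertices.1 hv).1
    have := hall f
    simpa [G, hv] using this
  rw [Matrix.rank, LinearMap.finrank_range_of_inj hinj, Module.finrank_fintype_fun_eq_card,
    Fintype.card_coe]

/-- The two incidence matrices have product zero, so their ranks add up to at most the number of
edges that are not bent. -/
theorem card_add_card_flatVertices_le {f₀ : RectangleFlag ι} (hf₀ : P.Bent f₀) :
    Fintype.card ι + P.flatVertices.card ≤ P.flatEdges.card + Nat.card P.Region := by
  have h1 := Matrix.rank_add_rank_le_card_of_mul_eq_zero P.faceMatrix_mul_vertexMatrix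
  have h2 := P.card_le_rank_faceMatrix
  rw [P.rank_vertexMatrix hf₀, Fintype.card_coe] at h1
  omega

theorem ncard_vertices : P.vertices.ncard = P.flatVertices.card + P.bentVertices.card := by
  classical
  have h : P.vertices = ((Finset.univ.image P.vert : Finset E3) : Set E3) := by
    ext v
    simp only [vertices, Set.mem_iUnion, Finset.coe_image, Finset.coe_univ, Set.image_univ,
      Set.mem_range]
    constructor
    · rintro ⟨i, k, rfl⟩
      exact ⟨(i, k, true), rfl⟩
    · rintro ⟨f, rfl⟩
      exact ⟨f.1, f.2.1, rfl⟩
  rw [h, Set.ncard_coe_finset, flatVertices, Finset.card_sdiff_add_card_eq_card]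
  exact Finset.image_subset_image (Finset.filter_subset _ _)

theorem ncard_edges : P.edges.ncard = P.flatEdges.card + P.bentEdges.card := by
  classical
  have h : P.edges = ((P.flatEdges ∪ P.bentEdges : Finset (Sym2 E3)) : Set (Sym2 E3)) := by
    ext e
    simp only [edges, Set.mem_iUnion, flatEdges, bentEdges, ← Finset.image_union,
      Finset.coe_image, Set.mem_image, Finset.mem_coe, Finset.mem_union, Finset.mem_filter,
      Finset.mem_univ, true_and]
    constructor
    · rintro ⟨i, k, rfl⟩
      exact ⟨(i, k, true), (em _).symm, rfl⟩
    · rintro ⟨f, -, rfl⟩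
      exact ⟨f.1, P.edge_mem_sides f⟩
  rw [h, Set.ncard_coe_finset, Finset.card_union_of_disjoint]
  rw [Finset.disjoint_left]
  intro e he he'
  obtain ⟨f, hf, rfl⟩ := P.mem_flatEdges.1 he
  simp only [bentEdges, Finset.mem_image, Finset.mem_filter, Finset.mem_univ, true_and] at he'
  obtain ⟨g, hg, hgf⟩ := he'
  exact hf (P.bent_of_edge_eq hgf.symm hg)

/-- The Euler characteristic of the surface is at most the number of vertices of the graph of bent
edges, minus the number of its edges, plus the number of regions. -/
theorem eulerChar_le {f₀ : RectangleFlag ι} (hf₀ : P.Bent f₀) :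
    P.eulerChar ≤ P.bentVertices.card - P.bentEdges.card + Nat.card P.Region := by
  have h := P.card_add_card_flatVertices_le hf₀
  rw [eulerChar, ncard_vertices, ncard_edges, Nat.card_eq_fintype_card (α := ι)]
  push_cast
  zify at h
  linarith

/-- A bent edge carries four flags, one for each choice of an end and of a face. -/
theorem card_bent_le : Nat.card {f // P.Bent f} ≤ 4 * P.bentEdges.card := by
  classical
  rw [Nat.card_eq_fintype_card, Fintype.card_subtype, bentEdges]
  refine Finset.card_le_mul_card_image _ _ fun e he => ?_
  obtain ⟨f, -, rfl⟩ := Finset.mem_image.1 he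
  refine (Finset.card_le_card (t := {f, reverse f, P.across f, reverse (P.across f)})
    fun g hg => ?_).trans Finset.card_le_four
  have := P.eq_of_edge_eq (Finset.mem_filter.1 hg).2
  simpa using this

/-! ### Counting turns -/

section Count

variable {P} {c : {f // P.Bent f} → {f // P.Bent f}}

theorem card_subtype_subtype {α : Type*} [Fintype α] (Q T : α → Prop) [DecidablePred Q]
    [DecidablePred T] : Nat.card {a : {b // Q b} // T a.1} =
      ((Finset.univ.filter T).filter Q).card := by
  rw [Nat.card_congr (Equiv.subtypeSubtypeEquivSubtypeInter Q T), Nat.card_eq_fintype_card,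
    Fintype.card_subtype]
  congr 1
  ext f
  simp [and_comm]

/-- The turns: sides of bent edges whose partner under `c` is perpendicular to them. -/
def IsTurn (c : {f // P.Bent f} → {f // P.Bent f}) (a : {f // P.Bent f}) : Prop :=
  ⟪P.dir a.1, P.dir (c a).1⟫ = 0

/-- The vertex inequality `8 + A ≤ 2 * N` for the number `N` of sides of bent edges and the number
`A` of turns at a vertex, strict if there is a turn. -/
theorem vertex_count [DecidableEq E3] [DecidablePred (IsTurn c)] [Fintype {f // P.Bent f}]
    (hc : ∀ a, c (c a) = a) (hne : ∀ a, c a ≠ a) (hv : ∀ a, P.vert (c a).1 = P.vert a.1)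
    (hr : ∀ a, P.regionOf (c a).1 = P.regionOf a.1) {v : E3} (h : v ∈ P.bentVertices) :
    8 + ((Finset.univ.filter (IsTurn c)).filter fun a => P.vert a.1 = v).card ≤
      2 * (Finset.univ.filter fun a : {f // P.Bent f} => P.vert a.1 = v).card ∧
    (0 < ((Finset.univ.filter (IsTurn c)).filter fun a => P.vert a.1 = v).card →
    8 + ((Finset.univ.filter (IsTurn c)).filter fun a => P.vert a.1 = v).card <
      2 * (Finset.univ.filter fun a : {f // P.Bent f} => P.vert a.1 = v).card) := by
  rw [← card_subtype_subtype (fun a : {f // P.Bent f} => P.vert a.1 = v) (IsTurn c),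
    ← Fintype.card_subtype, ← Nat.card_eq_fintype_card]
  let α := {a : {f // P.Bent f} // P.vert a.1 = v}
  let t' : α → α := fun a => ⟨⟨P.across a.1.1, (P.bent_across _).2 a.1.2⟩,
    (P.vert_across _).trans a.2⟩
  let c' : α → α := fun a => ⟨c a.1, (hv _).trans a.2⟩
  let p' : α → E3 := fun a => P.dir a.1.1
  have hpt : ∀ a, p' (t' a) = p' a := fun a => P.dir_across _
  have hpc : ∀ a, p' (c' a) ≠ p' a := fun a => dir_ne_of_region_eq hne hv hr a.1
  have hta : ∀ a, t' a ≠ a := fun a h => P.across_ne a.1.1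
    (congrArg (fun x : α => x.1.1) h)
  have hstrict : ∀ a : α, ⟪p' a, p' (c' a)⟫ = 0 →
      8 + Nat.card {a : α // IsTurn c a.1} < 2 * Nat.card α := fun a ha =>
    card_turns_lt t' c' p' (fun a => P.frame a.1.1)
      (fun a => Subtype.ext (hc _)) (fun a => Subtype.ext (Subtype.ext (P.across_across _)))
      (fun a => (P.face a.1.1.1).isFrame_frame) (fun a => P.dir_mem_frame _)
      (fun a => by
        show P.frame (c a.1).1 = _
        rw [frame_eq_regionFrame, hr, ← frame_eq_regionFrame])
      (fun a => a.1.2) hpt hpc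
      (fun a b hab => by
        have hvab : P.vert b.1.1 = P.vert a.1.1 := b.2.trans a.2.symm
        rcases P.eq_or_eq_across hvab (P.tip_eq_of_dir_eq hvab (Eq.symm hab)) with h | h
        · exact Or.inl (Subtype.ext (Subtype.ext h))
        · exact Or.inr (Subtype.ext (Subtype.ext h)))
      a ha
  refine ⟨?_, fun hpos => ?_⟩
  · rcases isEmpty_or_nonempty {a : α // IsTurn c a.1} with h0 | ⟨⟨a, ha⟩⟩
    · obtain ⟨f, hf, hfv⟩ := P.mem_bentVertices.1 h
      have : Nonempty α := ⟨⟨⟨f, hf⟩, hfv⟩⟩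
      have h4 := four_le_card_of_dir_ne t' c' p' hta hpt hpc
      have : Nat.card {a : α // IsTurn c a.1} = 0 := Nat.card_of_isEmpty
      have h4' : 4 ≤ Nat.card α := h4
      show 8 + Nat.card {a : α // IsTurn c a.1} ≤ 2 * Nat.card α
      omega
    · exact (hstrict a ha).le
  · obtain ⟨⟨a, ha⟩⟩ := (Nat.card_pos_iff.1 hpos).1
    exact hstrict a ha

/-- Every region is bounded by some bent edge if there are any. -/
theorem exists_bent_of_region {f₀ : RectangleFlag ι} (hf₀ : P.Bent f₀) (q : P.Region) :
    ∃ f, P.Bent f ∧ P.regionOf f = q := by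
  by_contra! hcon
  obtain ⟨i, rfl⟩ := Quot.exists_rep q
  refine hcon f₀ hf₀ (P.forall_of_across
    (Q := fun j => Quot.mk P.FaceAdj j = Quot.mk P.FaceAdj i) (fun f hf => ?_) rfl f₀.1)
  exact (P.regionOf_across fun hb => hcon f hb hf).trans hf

/-- The region inequality: every region has at least eight turns. -/
theorem region_count [DecidableEq P.Region] [DecidablePred (IsTurn c)] [Fintype {f // P.Bent f}]
    (hc : ∀ a, c (c a) = a) (hne : ∀ a, c a ≠ a) (hv : ∀ a, P.vert (c a).1 = P.vert a.1)
    (hr : ∀ a, P.regionOf (c a).1 = P.regionOf a.1) {f₀ : RectangleFlag ι} (hf₀ : P.Bent f₀)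
    (q : P.Region) :
    8 ≤ ((Finset.univ.filter (IsTurn c)).filter fun a => P.regionOf a.1 = q).card := by
  rw [← card_subtype_subtype (fun a : {f // P.Bent f} => P.regionOf a.1 = q) (IsTurn c)]
  let α := {a : {f // P.Bent f} // P.regionOf a.1 = q}
  obtain ⟨f, hf, hfq⟩ := exists_bent_of_region hf₀ q
  have : Nonempty α := ⟨⟨⟨f, hf⟩, hfq⟩⟩
  refine eight_le_card_turns (α := α) (S := P.regionFrame q)
    (hfq ▸ (P.face f.1).isFrame_frame)
    (fun a => ⟨⟨reverse a.1.1, (P.bent_reverse _).2 a.1.2⟩, a.2⟩)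
    (fun a => ⟨c a.1, (hr _).trans a.2⟩)
    (fun a => P.vert a.1.1) (fun a => P.dir a.1.1) (fun a => ‖P.tip a.1.1 - P.vert a.1.1‖)
    (fun a => Subtype.ext (Subtype.ext (reverse_reverse _))) (fun a => Subtype.ext (hc _))
    (fun a => by
      have hq : P.regionFrame q = P.frame a.1.1 := by rw [frame_eq_regionFrame, a.2]
      exact hq ▸ P.dir_mem_frame _)
    (fun a => P.tip_sub_vert a.1.1) (fun a => P.edge_length_pos _) (fun a => P.dir_reverse _)
    (fun a => hv _) (fun a => dir_ne_of_region_eq hne hv hr a.1)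

end Count

/-- A surface with a bent edge has negative Euler characteristic. -/
theorem eulerChar_neg {f₀ : RectangleFlag ι} (hf₀ : P.Bent f₀) : P.eulerChar < 0 := by
  classical
  have : Fintype P.Region := Fintype.ofFinite _
  obtain ⟨c, hc, hne, hκ⟩ := exists_involutive_of_even_fibers
    (fun a : {f // P.Bent f} => (P.vert a.1, P.regionOf a.1)) P.even_card_bent
  have hv : ∀ a, P.vert (c a).1 = P.vert a.1 := fun a => congrArg Prod.fst (hκ a)
  have hr : ∀ a, P.regionOf (c a).1 = P.regionOf a.1 := fun a => congrArg Prod.snd (hκ a)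
  have hmaps : ∀ a : {f // P.Bent f}, P.vert a.1 ∈ P.bentVertices := fun a =>
    P.mem_bentVertices.2 ⟨a.1, a.2, rfl⟩
  set A : Finset {f // P.Bent f} := Finset.univ.filter (IsTurn c) with hA
  have hN : Nat.card {f // P.Bent f} = ∑ v ∈ P.bentVertices,
      (Finset.univ.filter fun a : {f // P.Bent f} => P.vert a.1 = v).card := by
    rw [Nat.card_eq_fintype_card, ← Finset.card_univ]
    exact Finset.card_eq_sum_card_fiberwise fun a _ => hmaps a
  have hAv : A.card = ∑ v ∈ P.bentVertices, (A.filter fun a => P.vert a.1 = v).card :=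
    Finset.card_eq_sum_card_fiberwise fun a _ => hmaps a
  have hAr : A.card = ∑ q : P.Region, (A.filter fun a => P.regionOf a.1 = q).card :=
    Finset.card_eq_sum_card_fiberwise fun a _ => Finset.mem_coe.2 (Finset.mem_univ _)
  have hreg := fun q => region_count hc hne hv hr hf₀ q
  have h8 : 8 * Nat.card P.Region ≤ A.card := by
    rw [hAr, Nat.card_eq_fintype_card, mul_comm, ← smul_eq_mul, ← Finset.card_univ]
    exact Finset.card_nsmul_le_sum _ _ _ fun q _ => hreg q
  have hpos : 0 < A.card := by
    have : 0 < Nat.card P.Region := Nat.card_pos_iff.2 ⟨⟨P.regionOf f₀⟩, inferInstance⟩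
    omega
  obtain ⟨a, ha⟩ := Finset.card_pos.1 hpos
  have hlt : 8 * P.bentVertices.card + A.card < 2 * Nat.card {f // P.Bent f} := by
    rw [hAv, hN, Finset.mul_sum, mul_comm, ← smul_eq_mul, ← Finset.sum_const,
      ← Finset.sum_add_distrib]
    refine Finset.sum_lt_sum (fun v hv' => (vertex_count hc hne hv hr hv').1)
      ⟨P.vert a.1, hmaps a, (vertex_count hc hne hv hr (hmaps a)).2 ?_⟩
    exact Finset.card_pos.2 ⟨a, Finset.mem_filter.2 ⟨ha, rfl⟩⟩
  have h1 := P.eulerChar_le hf₀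
  have h2 := P.card_bent_le
  zify at h8 hlt h2
  linarith

end RectangularPolyhedron

theorem mainTheorem1 {ι : Type*} [Finite ι] (P : RectangularPolyhedron ι) (g : ℕ)
    (hg : P.HasGenus g) (hg_le : g ≤ 1) : P.IsOrthogonal := by
  have := Fintype.ofFinite ι
  have hflat : ∀ f, ¬ P.Bent f := fun f hf => by
    have h := P.eulerChar_neg hf
    rw [hg] at h
    omega
  intro i j k l hij hkl
  refine (P.face i).angle_eq_mul_pi_div_two ?_ k l
  have hj : P.edge (i, k, true) ∈ (P.face j).sides := ⟨l, hkl.symm⟩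
  rcases P.face_eq_or_of_edge_mem hj with h | h
  · exact absurd h.symm hij
  · rw [h]
    exact (not_not.1 (hflat (i, k, true))).symm
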